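/- Conventions. Let $\mathsf T$ be a triangulated category with suspension $\Sigma$ and small coproducts, and $\mathsf T^c$ its full subcategory of compact objects. For full subcategories, $\mathsf A\star\mathsf C$ denotes the objects $B$ in a triangle $A\to B\to C\to\Sigma A$ with $A\in\mathsf A$, $C\in\mathsf C$; $\mathsf A^\perp=\{c:\operatorname{Hom}(\mathsf A,c)=0\}$ and ${}^\perp\mathsf A=\{c:\operatorname{Hom}(c,\mathsf A)=0\}$, taken in $\mathsf T$; $\operatorname{smd}$ is closure under direct summands; $\operatorname{coprod}(\mathsf U)$ is the closure of $\mathsf U$ under finite direct sums and extensions; $\operatorname{Coprod}_1(\mathsf U)$ consists of the small coproducts of objects of $\mathsf U$, and $\operatorname{Coprod}_{n+1}(\mathsf U)=\operatorname{Coprod}_1(\mathsf U)\star\operatorname{Coprod}_n(\mathsf U)$. For a sequence $\mathcal G=\{\mathcal G^n\}_{n\in\mathbb Z}$ of full subcategories of $\mathsf T^c$ and an interval $I$, put $\mathcal G^{I}=\operatorname{smd}(\operatorname{coprod}(\bigcup_{n\in I}\mathcal G^n))$ and $\overline{\mathcal G}{}^{I}_{A}=\operatorname{smd}(\operatorname{Coprod}_A(\bigcup_{n\in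 I}\mathcal G^n))$. If $\mathsf T$ is compactly generated, $\mathcal G$ is a *generating sequence* if $\mathcal G^{(-\infty,\infty)}=\mathsf T^c$ and $\Sigma^{-1}\mathcal G^n\cup\mathcal G^n\cup\Sigma\mathcal G^n\subseteq\mathcal G^{[n-1,n+1]}$ for all $n$; it is *finite* if each $\mathcal G^n$ has finitely many objects. Put $\mathcal M^{\mathcal G}_n=\mathcal G^{(-\infty,-n]}$, $\mathcal R^{\mathcal G}_n={}^\perp((\mathcal M^{\mathcal G}_n)^\perp)$, $$\overline{\mathsf T^c}=\bigcap_{n\in\mathbb Z}\mathsf T^c\star\mathcal R^{\mathcal G}_n,\qquad \mathsf T^b_c=\overline{\mathsf T^c}\cap\bigcup_{n\in\mathbb Z}(\mathcal M^{\mathcal G}_n)^\perp .$$ An *orthogonal metric* on $\mathsf T$ is a sequence $\{\mathcal R_n\}_{n\in\mathbb Z}$ of strictly full subcategories containing $0$ such that, for all $n$, $\mathcal R_n\star\mathcal R_n\subseteq\mathcal R_n$, $\Sigma^{-1}\mathcal R_{n+1}\cup\mathcal R_{n+1}\cup\Sigma\mathcal R_{n+1}\subseteq\mathcal R_n$ and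 ${}^\perp(\mathcal R_n^\perp)=\mathcal R_n$. A compactly generated $\mathsf T$ with a generating sequence $\mathcal G$ is *$\mathcal G$-quasiapproximable* if there are an orthogonal metric $\mathcal R$ on $\mathsf T$ and an integer $A>0$ such that (0) $\mathcal M^{\mathcal G}_i\subseteq\bigcup_{|n|\le A}\Sigma^n\mathcal M^{\mathcal G}_{i+1}$ for all $i\in\mathbb Z$; (1) $\mathcal M^{\mathcal G}_{i+A}\subseteq\mathcal R_i$ for all $i\in\mathbb Z$; (2) $\operatorname{Hom}(\mathcal G^n,\mathcal R_i)=0$ whenever $n+i\ge A$; (3) for all $i\in\mathbb Z$ and $F\in\mathcal R_i\cap\overline{\mathsf T^c}$ there is a triangle $E\to F\to D\to\Sigma E$ with $E\in\overline{\mathcal G}{}^{[-A-i,A-i]}_{A}$ and $D\in\mathcal R_{i+1}\cap\overline{\mathsf T^c}$. If $\mathsf T$ is $R$-linear, a *$\mathsf T^c$-cohomological functor* is an $R$-linear functor $H:[\mathsf T^c]^{\mathrm{op}}\to\operatorname{Mod}(R)$ such that $H(Z)\to H(Y)\to H(X)$ is exact for every triangle $X\to Y\to Z\to\Sigma X$ in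 $\mathsf T^c$; it is *$\mathcal G$-finite* if $H(K)$ is a finitely generated $R$-module for all $K\in\mathsf T^c$ and $H(\mathcal G^i)=0$ for $|i|\gg0$. **Theorem.** Let $R$ be a commutative noetherian ring and $\mathsf T$ an $R$-linear triangulated category which is $\mathcal G$-quasiapproximable for a finite generating sequence $\mathcal G$, and assume that $\operatorname{Hom}_{\mathsf T}(G,G')$ is a finitely generated $R$-module for all $G,G'\in\bigcup_{n\in\mathbb Z}\mathcal G^n$. Then the functor $\mathcal Y|_{\mathsf T^b_c}:\mathsf T^b_c\to\operatorname{Hom}([\mathsf T^c]^{\mathrm{op}},\operatorname{Mod}(R))$, $F\mapsto\operatorname{Hom}_{\mathsf T}(-,F)|_{\mathsf T^c}$, satisfies: (1) its essential image consists exactly of the $\mathcal G$-finite $\mathsf T^c$-cohomological functors; (2) it is fully faithful. -/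

import Mathlib

open CategoryTheory CategoryTheory.Limits CategoryTheory.Pretriangulated Opposite

universe w v u

namespace GApprox

section Triangulated

variable {T : Type u} [Category.{v} T] [HasZeroObject T] [HasShift T ℤ] [Preadditive T]
  [∀ n : ℤ, (shiftFunctor T n).Additive] [Pretriangulated T]

variable (T) in
/-- The compact objects `Tᶜ`: those `K` such that `Hom(K, -)`, as a functor to abelian groups,
preserves all small coproducts. -/
def compacts : ObjectProperty T :=
  fun K => ∀ J : Type v, PreservesColimitsOfShape (Discrete J) (preadditiveCoyoneda.obj (op K))

variable (T) in
/-- `T` has small coproducts, and a small set of compact objects generates `T`. -/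
structure IsCompactlyGenerated : Prop where
  hasCoproducts : HasCoproducts.{v} T
  exists_generators : ∃ S : ObjectProperty T, ObjectProperty.EssentiallySmall.{v} S ∧
    S ≤ compacts T ∧
    ∀ X : T, (∀ K : T, S K → ∀ (n : ℤ) (f : K⟦n⟧ ⟶ X), f = 0) → IsZero X

/-- `coprod(U)`: the closure of `U` under finite direct sums (the empty one included) and
extensions; it is closed under isomorphisms, as `sum` applies to families with one member. -/
inductive coprod (U : ObjectProperty T) : ObjectProperty T
  | of (X : T) (hX : U X) : coprod U X
  | sum {n : ℕ} (f : Fin n → T) (c : Cofan f) (hc : IsColimit c) (hf : ∀ i, coprod U (f i)) :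
      coprod U c.pt
  | ext (X Y Z : T) (a : X ⟶ Y) (b : Y ⟶ Z) (c : Z ⟶ X⟦(1 : ℤ)⟧)
      (h : Triangle.mk a b c ∈ distTriang T) (hX : coprod U X) (hZ : coprod U Z) : coprod U Y

/-- `Add(U)`: the small coproducts of objects of `U`. -/
def bigAdd (U : ObjectProperty T) : ObjectProperty T :=
  fun X => ∃ J : Type v, U.colimitsOfShape (Discrete J) X

/-- `Coprod_n(U)` for `n ≥ 1`: `Coprod_1(U) = Add(U)` and
`Coprod_{n+1}(U) = Coprod_1(U) ⋆ Coprod_n(U)`. (The value at `n = 0` is not used.) -/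
def bigCoprod (U : ObjectProperty T) (n : ℕ) : ObjectProperty T :=
  (bigAdd U).extensionProductIter (n - 1)

/-- The union of the `𝒢ⁿ` with `n` in a set `I` of integers. -/
def slice (G : ℤ → ObjectProperty T) (I : Set ℤ) : ObjectProperty T :=
  fun X => ∃ n ∈ I, G n X

/-- `𝒢ᴵ = smd(coprod(⋃_{n ∈ I} 𝒢ⁿ))`. In a triangulated category the direct summands of an object
are its retracts. -/
def small (G : ℤ → ObjectProperty T) (I : Set ℤ) : ObjectProperty T :=
  (coprod (slice G I)).retractClosure

/-- The big category `smd(Coprod_n(⋃_{m ∈ I} 𝒢ᵐ))`, for `n ≥ 1`. -/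
def big (G : ℤ → ObjectProperty T) (I : Set ℤ) (n : ℕ) : ObjectProperty T :=
  (bigCoprod (slice G I) n).retractClosure

/-- Generating sequences. -/
structure IsGeneratingSequence (G : ℤ → ObjectProperty T) : Prop where
  le_compacts : ∀ n, G n ≤ compacts T
  generates : small G Set.univ = compacts T
  shift_neg : ∀ (n : ℤ) (X : T), G n X → small G (Set.Icc (n - 1) (n + 1)) (X⟦(-1 : ℤ)⟧)
  self : ∀ (n : ℤ) (X : T), G n X → small G (Set.Icc (n - 1) (n + 1)) X
  shift_pos : ∀ (n : ℤ) (X : T), G n X → small G (Set.Icc (n - 1) (n + 1)) (X⟦(1 : ℤ)⟧)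

/-- Generating sequences such that each `𝒢ⁿ` has only finitely many objects. -/
structure IsFiniteGeneratingSequence (G : ℤ → ObjectProperty T) : Prop
    extends IsGeneratingSequence G where
  finite : ∀ n, {X : T | G n X}.Finite

/-- Extended good metrics on `T`. -/
structure IsExtendedGoodMetric (M : ℤ → ObjectProperty T) : Prop where
  isoClosed : ∀ n, (M n).IsClosedUnderIsomorphisms
  containsZero : ∀ n, (M n).ContainsZero
  ext : ∀ n, ObjectProperty.extensionProduct (M n) (M n) ≤ M n
  shift_neg : ∀ (n : ℤ) (X : T), M (n + 1) X → M n (X⟦(-1 : ℤ)⟧)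
  anti : ∀ (n : ℤ) (X : T), M (n + 1) X → M n X
  shift_pos : ∀ (n : ℤ) (X : T), M (n + 1) X → M n (X⟦(1 : ℤ)⟧)

/-- Orthogonal metrics on `T`. -/
structure IsOrthogonalMetric (M : ℤ → ObjectProperty T) : Prop
    extends IsExtendedGoodMetric M where
  orthogonal : ∀ n, (M n).rightOrthogonal.leftOrthogonal = M n

/-- The metric on the compact objects attached to `𝒢`: its `n`-th term is `𝒢^{(-∞, -n]}`. -/
def metricM (G : ℤ → ObjectProperty T) (n : ℤ) : ObjectProperty T :=
  small G (Set.Iic (-n))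

/-- The orthogonal metric on `T` attached to `𝒢`, with orthogonals taken in `T`. -/
def metricR (G : ℤ → ObjectProperty T) (n : ℤ) : ObjectProperty T :=
  (metricM G n).rightOrthogonal.leftOrthogonal

/-- The closure of the compacts, computed with respect to the metric `metricR G`. -/
def closureCompacts (G : ℤ → ObjectProperty T) : ObjectProperty T :=
  fun X => ∀ n : ℤ, ObjectProperty.extensionProduct (compacts T) (metricR G n) X

/-- `T^b_c`: the objects of the closure of the compacts which are right orthogonal to some term
of the metric `metricM G`. -/
def boundedClosure (G : ℤ → ObjectProperty T) : ObjectProperty T :=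
  fun X => closureCompacts G X ∧ ∃ n : ℤ, (metricM G n).rightOrthogonal X

/-- The conditions of `𝒢`-preapproximability for an orthogonal metric `M` and an integer `A`. -/
structure IsPreapproximableWith (G M : ℤ → ObjectProperty T) (A : ℕ) : Prop where
  shift : ∀ (i : ℤ) (X : T), metricM G i X →
    ∃ n : ℤ, |n| ≤ A ∧ ∃ Y : T, metricM G (i + 1) Y ∧ Nonempty (X ≅ Y⟦n⟧)
  le : ∀ i : ℤ, metricM G (i + A) ≤ M i
  eventually_orthogonal : ∀ n : ℤ, ∃ N : ℤ, ∀ i ≥ N, M i ≤ (G n).rightOrthogonal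

/-- `𝒢`-quasiapproximability of `T`, for a generating sequence `𝒢`. -/
structure IsQuasiapproximable (G : ℤ → ObjectProperty T) : Prop where
  compactlyGenerated : IsCompactlyGenerated T
  generatingSequence : IsGeneratingSequence G
  exists_metric : ∃ (M : ℤ → ObjectProperty T) (A : ℕ), 0 < A ∧ IsOrthogonalMetric M ∧
    IsPreapproximableWith G M A ∧
    (∀ n i : ℤ, (A : ℤ) ≤ n + i → M i ≤ (G n).rightOrthogonal) ∧
    ∀ (i : ℤ) (F : T), M i F → closureCompacts G F →
      ∃ (E D : T) (a : E ⟶ F) (b : F ⟶ D) (c : D ⟶ E⟦(1 : ℤ)⟧),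
        Triangle.mk a b c ∈ distTriang T ∧ big G (Set.Icc (-A - i) (A - i)) A E ∧
          M (i + 1) D ∧ closureCompacts G D

variable {R : Type w} [CommRing R] [Linear R T]

/-- The `Tᶜ`-cohomological functors: the `R`-linear functors `(Tᶜ)ᵒᵖ ⥤ Mod(R)` which take the
triangles of `T` with compact vertices to exact sequences. -/
structure IsCohomological (H : (compacts T).FullSubcategoryᵒᵖ ⥤ ModuleCat.{v} R) : Prop where
  additive : H.Additive
  map_smul : ∀ {K L : (compacts T).FullSubcategory} (f : K ⟶ L) (r : R),
    H.map (r • f).op = r • H.map f.op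
  exact : ∀ (X Y Z : (compacts T).FullSubcategory) (a : X ⟶ Y) (b : Y ⟶ Z)
    (c : Z.obj ⟶ X.obj⟦(1 : ℤ)⟧), Triangle.mk a.hom b.hom c ∈ distTriang T →
    Function.Exact (H.map b.op).hom (H.map a.op).hom

/-- The `𝒢`-finite `Tᶜ`-cohomological functors. -/
structure IsGFinite (G : ℤ → ObjectProperty T)
    (H : (compacts T).FullSubcategoryᵒᵖ ⥤ ModuleCat.{v} R) : Prop extends IsCohomological H where
  finite : ∀ K : (compacts T).FullSubcategory, Module.Finite R (H.obj (op K))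
  bounded : ∃ N : ℤ, ∀ i : ℤ, N ≤ |i| → ∀ K : (compacts T).FullSubcategory, G i K.obj →
    Subsingleton (H.obj (op K))

variable (T R) in
/-- The restricted Yoneda functor `F ↦ Hom(-, F)|_{Tᶜ}`. -/
noncomputable def restrictedYoneda :
    T ⥤ (compacts T).FullSubcategoryᵒᵖ ⥤ ModuleCat.{v} R :=
  linearYoneda R T ⋙ (Functor.whiskeringLeft _ _ _).obj (compacts T).ι.op

variable (R) in
/-- The restriction of the restricted Yoneda functor to `T^b_c`. -/
noncomputable def restrictedYonedaBounded (G : ℤ → ObjectProperty T) :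
    (boundedClosure G).FullSubcategory ⥤ (compacts T).FullSubcategoryᵒᵖ ⥤ ModuleCat.{v} R :=
  (boundedClosure G).ι ⋙ restrictedYoneda T R

end Triangulated

end GApprox

/-! Full faithfulness. If `F` lies in the closure of the compacts and `F'` is right orthogonal to
`metricM G n`, take a triangle `E ⟶ F ⟶ D` with `E` compact and `D` in `metricR G (n + 1)`. Neither
`D` nor its desuspension maps to `F'`, so `Hom(F, F') = Hom(E, F')` is visible on compacts
(`hom_ext_of_compacts`, `exists_hom_of_natural`). The same triangles show that `Hom(-, F)` has
finitely generated values. It vanishes on `𝒢ʲ` for `j ≫ 0` because `F` lies in some term of the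
metric, and for `j ≪ 0` by the definition of `T^b_c`.

Essential surjectivity. A `𝒢`-finite `H` is represented on compacts by a homotopy colimit `F` of
compact objects, built by adding generators and killing relations on finitely many test objects at a
time (`exists_step`, `exists_representing`). The hard point is that `F` lies in the closure
(`closure_of_bounded`). What is known of `F`, besides finiteness, is that `Hom(𝒢ʲ, F) = 0` for `j ≫
0` and that a phantom out of `F` followed by a phantom is zero.

Maps `F ⟶ C` are built with fibre in the closure and in one fixed term of the metric. Compact covers
yield only ghosts `C ⟶ C'`, killing maps from the `𝒢ʲ` themselves. But the fibre of a map between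
stages stays in a fixed term of the metric, so quasiapproximability approximates it by objects of
uniformly bounded ghost length, and a fixed number of ghosts kills all maps from `𝒢^{[m,∞)}`
(`exists_kill_small`). Doing this twice and truncating by torsion pairs gives phantoms `F ⟶ C₁'` and
`C₁' ⟶ C₂'`. Their composite vanishes, so for every `q` the object `F` is a summand of some `Y` in a
triangle `P ⟶ Y ⟶ X` with `P` in the closure and `X` in `metricR G q` (`exists_retract_triangle`).

It remains to split off the summand. If `Y = F ⊞ F'`, the map `F ⊞ F' ⟶ F' ⟶ F' ⊞ F` has cone `F⟦1⟧
⊞ F`, which is therefore in the closure; iterating, so is `F⟦n⟧ ⊞ F` for `n` odd. Condition (0)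
provides such an `n` with `F⟦n⟧` deep in the metric, where it is absorbed into the error term
(`exists_odd_shift`, `closure_of_biprod_shift`). -/

set_option linter.unusedSectionVars false

namespace GApprox

/-! ### Triangles, closure properties and orthogonals -/

section Basics

variable {T : Type u} [Category.{v} T] [HasZeroObject T] [HasShift T ℤ] [Preadditive T]
  [∀ n : ℤ, (shiftFunctor T n).Additive] [Pretriangulated T]

section Triangles

variable {X Y Z : T} {a : X ⟶ Y} {b : Y ⟶ Z} {c : Z ⟶ X⟦(1 : ℤ)⟧}

lemma dist_comp₁₂ (h : Triangle.mk a b c ∈ distTriang T) : a ≫ b = 0 := comp_distTriang_mor_zero₁₂ _ h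

lemma dist_comp₂₃ (h : Triangle.mk a b c ∈ distTriang T) : b ≫ c = 0 := comp_distTriang_mor_zero₂₃ _ h

lemma dist_comp₃₁ (h : Triangle.mk a b c ∈ distTriang T) : c ≫ a⟦(1 : ℤ)⟧' = 0 := comp_distTriang_mor_zero₃₁ _ h

lemma dist_rotate (h : Triangle.mk a b c ∈ distTriang T) : Triangle.mk b c (-a⟦(1 : ℤ)⟧') ∈ distTriang T := rot_of_distTriang _ h

lemma dist_lift₁ (h : Triangle.mk a b c ∈ distTriang T)
    {W : T} (f : W ⟶ Y) (hf : f ≫ b = 0) : ∃ g : W ⟶ X, g ≫ a = f := by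
  obtain ⟨g, hg⟩ := Triangle.coyoneda_exact₂ _ h f hf
  exact ⟨g, hg.symm⟩

lemma dist_lift₂ (h : Triangle.mk a b c ∈ distTriang T)
    {W : T} (f : W ⟶ Z) (hf : f ≫ c = 0) : ∃ g : W ⟶ Y, g ≫ b = f := by
  obtain ⟨g, hg⟩ := Triangle.coyoneda_exact₃ _ h f hf
  exact ⟨g, hg.symm⟩

lemma dist_desc₃ (h : Triangle.mk a b c ∈ distTriang T)
    {W : T} (f : Y ⟶ W) (hf : a ≫ f = 0) : ∃ g : Z ⟶ W, b ≫ g = f := by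
  obtain ⟨g, hg⟩ := Triangle.yoneda_exact₂ _ h f hf
  exact ⟨g, hg.symm⟩

lemma dist_desc₄ (h : Triangle.mk a b c ∈ distTriang T)
    {W : T} (f : Z ⟶ W) (hf : b ≫ f = 0) : ∃ g : X⟦(1 : ℤ)⟧ ⟶ W, c ≫ g = f := by
  obtain ⟨g, hg⟩ := Triangle.yoneda_exact₃ _ h f hf
  exact ⟨g, hg.symm⟩

end Triangles

/-- Properties of objects closed under zero objects, extensions and retracts. -/
structure ExtRetractClosed (P : ObjectProperty T) : Prop where
  zero : ∀ X : T, IsZero X → P X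
  ext : ∀ {X Y Z : T} {a : X ⟶ Y} {b : Y ⟶ Z} {c : Z ⟶ X⟦(1 : ℤ)⟧},
    Triangle.mk a b c ∈ distTriang T → P X → P Z → P Y
  retract : ∀ {X Y : T}, Retract X Y → P Y → P X

namespace ExtRetractClosed

variable {P : ObjectProperty T}

lemma iso (hP : ExtRetractClosed P) {X Y : T} (e : X ≅ Y) (hX : P X) : P Y :=
  hP.retract (Retract.ofIso e.symm) hX

lemma biprod (hP : ExtRetractClosed P) {X Y : T} (hX : P X) (hY : P Y) : P (X ⊞ Y) :=
  hP.ext (binaryBiproductTriangle_distinguished X Y) hX hY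

lemma cofan (hP : ExtRetractClosed P) {n : ℕ} (f : Fin n → T) (c : Cofan f) (hc : IsColimit c)
    (hf : ∀ i, P (f i)) : P c.pt := by
  have : P.IsClosedUnderIsomorphisms := ⟨fun e h => hP.iso e h⟩
  have : P.ContainsZero := ⟨_, isZero_zero T, hP.zero _ (isZero_zero T)⟩
  have : P.IsClosedUnderBinaryProducts :=
    { limitsOfShape_le := by
        rintro X ⟨p⟩
        refine P.prop_of_iso ?_ (hP.ext (binaryProductTriangle_distinguished _ _)
          (p.prop_diag_obj (.mk .left)) (p.prop_diag_obj (.mk .right)))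
        exact IsLimit.conePointUniqueUpToIso (prodIsProd _ _)
          ((IsLimit.postcomposeHomEquiv (diagramIsoPair p.diag) _).2 p.isLimit) }
  have : P.IsClosedUnderFiniteProducts := .mk'
  exact hP.iso ((biproduct.isoProduct f).symm ≪≫
    (IsColimit.coconePointUniqueUpToIso (biproduct.isColimit f) hc)) (P.prop_product hf)

lemma coprod_le (hP : ExtRetractClosed P) {U : ObjectProperty T} (h : U ≤ P) : coprod U ≤ P := by
  intro X hX
  induction hX with
  | of X hX => exact h X hX
  | sum f c hc _ ih => exact hP.cofan f c hc ih
  | ext X Y Z a b c hT _ _ ihX ihZ => exact hP.ext hT ihX ihZ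

lemma small_le (hP : ExtRetractClosed P) {G : ℤ → ObjectProperty T} {I : Set ℤ}
    (h : slice G I ≤ P) : small G I ≤ P := by
  rintro X ⟨Y, hY, ⟨r⟩⟩
  exact hP.retract r (hP.coprod_le h Y hY)

end ExtRetractClosed

lemma coprod_zero (U : ObjectProperty T) (X : T) (hX : IsZero X) : coprod U X := by
  let c : Cofan (fun i : Fin 0 => (i.elim0 : T)) := Cofan.mk X (fun i => i.elim0)
  have hc : IsColimit c := Cofan.IsColimit.mk _ (fun s => hX.to_ s.pt) (fun s i => i.elim0)
    (fun s m _ => hX.eq_of_src _ _)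
  exact coprod.sum _ c hc (fun i => i.elim0)

/-- An extension of summands is a summand of an extension, so taking summands once, at the end, is
enough. -/
lemma coprod_retractClosure_extRetractClosed (U : ObjectProperty T) :
    ExtRetractClosed (coprod U).retractClosure where
  zero X h := ObjectProperty.le_retractClosure _ _ (coprod_zero U X h)
  ext h hX hZ := by
    obtain ⟨Y', ⟨X', Z', a, b, c, hT, hX', hZ'⟩, r⟩ :=
      ObjectProperty.extensionProduct_retractClosure_retractClosure_le (coprod U) (coprod U) _
        ⟨_, _, _, _, _, h, hX, hZ⟩
    exact ⟨Y', .ext _ _ _ _ _ _ hT hX' hZ', r⟩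
  retract r hY := ObjectProperty.prop_of_retract _ r hY

lemma small_extRetractClosed (G : ℤ → ObjectProperty T) (I : Set ℤ) :
    ExtRetractClosed (small G I) := coprod_retractClosure_extRetractClosed _

lemma slice_le_small (G : ℤ → ObjectProperty T) (I : Set ℤ) : slice G I ≤ small G I :=
  fun X hX => ObjectProperty.le_retractClosure _ _ (.of X hX)

lemma slice_mono (G : ℤ → ObjectProperty T) {I J : Set ℤ} (h : I ⊆ J) : slice G I ≤ slice G J :=
  fun _ ⟨n, hn, hX⟩ => ⟨n, h hn, hX⟩

lemma small_mono (G : ℤ → ObjectProperty T) {I J : Set ℤ} (h : I ⊆ J) : small G I ≤ small G J :=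
  (small_extRetractClosed G J).small_le ((slice_mono G h).trans (slice_le_small G J))

lemma leftOrthogonal_extRetractClosed (P : ObjectProperty T) :
    ExtRetractClosed P.leftOrthogonal where
  zero X h Y f _ := h.eq_of_src _ _
  ext {X Y Z a b c} h hX hZ W f hW := by
    obtain ⟨g, rfl⟩ : ∃ g : Z ⟶ W, f = b ≫ g := Triangle.yoneda_exact₂ _ h f (hX _ hW)
    rw [hZ g hW, comp_zero]
  retract r hY W f hW := by
    rw [← Category.id_comp f, ← r.retract, Category.assoc, hY (r.r ≫ f) hW, comp_zero]

lemma small_hom_eq_zero {G : ℤ → ObjectProperty T} {I : Set ℤ} {X : T}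
    (h : ∀ n ∈ I, ∀ K, G n K → ∀ f : K ⟶ X, f = 0) {K : T} (hK : small G I K) (f : K ⟶ X) :
    f = 0 := by
  let P : ObjectProperty T := fun Y => ∀ n ∈ I, ∀ K, G n K → ∀ f : K ⟶ Y, f = 0
  exact (leftOrthogonal_extRetractClosed P).small_le
    (fun L ⟨n, hn, hL⟩ Y g hY => hY n hn L hL g) K hK f h

lemma metricM_rightOrthogonal_iff (G : ℤ → ObjectProperty T) (n : ℤ) (X : T) :
    (metricM G n).rightOrthogonal X ↔ ∀ j ≤ -n, ∀ K, G j K → ∀ f : K ⟶ X, f = 0 := by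
  constructor
  · intro h j hj K hK f
    exact h f (slice_le_small G _ _ ⟨j, hj, hK⟩)
  · intro h K f hK
    exact small_hom_eq_zero (I := Set.Iic (-n)) h hK f

end Basics

/-! ### Shifts and the metric attached to `𝒢` -/

section ShiftHom

variable {T : Type u} [Category.{v} T] [HasZeroObject T] [HasShift T ℤ] [Preadditive T]
  [∀ n : ℤ, (shiftFunctor T n).Additive]

lemma hom_shift_eq_zero {X Y : T} {a b : ℤ} (hab : a + b = 0)
    (h : ∀ f : X⟦a⟧ ⟶ Y, f = 0) (f : X ⟶ Y⟦b⟧) : f = 0 := by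
  apply (shiftFunctor T a).map_injective
  rw [Functor.map_zero, ← cancel_mono ((shiftFunctorCompIsoId T b a (by omega)).hom.app Y),
    zero_comp]
  exact h _

lemma shift_hom_eq_zero {X Y : T} {a b : ℤ} (hab : a + b = 0)
    (h : ∀ f : X ⟶ Y⟦b⟧, f = 0) (f : X⟦a⟧ ⟶ Y) : f = 0 := by
  apply (shiftFunctor T b).map_injective
  rw [Functor.map_zero, ← cancel_epi ((shiftFunctorCompIsoId T a b (by omega)).inv.app X),
    comp_zero]
  exact h _

end ShiftHom

section MetricR

variable {T : Type u} [Category.{v} T] [HasZeroObject T] [HasShift T ℤ] [Preadditive T]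
  [∀ n : ℤ, (shiftFunctor T n).Additive] [Pretriangulated T] {G : ℤ → ObjectProperty T}

lemma metricR_extRetractClosed (G : ℤ → ObjectProperty T) (n : ℤ) :
    ExtRetractClosed (metricR G n) := leftOrthogonal_extRetractClosed _

lemma metricM_le_metricR (G : ℤ → ObjectProperty T) (n : ℤ) : metricM G n ≤ metricR G n :=
  fun _ hX _ f hY => hY f hX

lemma metricM_anti (G : ℤ → ObjectProperty T) {m n : ℤ} (h : m ≤ n) : metricM G n ≤ metricM G m :=
  small_mono G (Set.Iic_subset_Iic.2 (by omega))

lemma metricM_rightOrthogonal_mono (G : ℤ → ObjectProperty T) {m n : ℤ} (h : m ≤ n) :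
    (metricM G m).rightOrthogonal ≤ (metricM G n).rightOrthogonal :=
  fun _ hX _ f hK => hX f (metricM_anti G h _ hK)

lemma metricR_anti (G : ℤ → ObjectProperty T) {m n : ℤ} (h : m ≤ n) : metricR G n ≤ metricR G m :=
  fun _ hX _ f hY => hX f (metricM_rightOrthogonal_mono G h _ hY)

lemma IsGeneratingSequence.shift_small (hG : IsGeneratingSequence G) {n a : ℤ} (ha : a.natAbs ≤ 1)
    {X : T} (hX : G n X) : small G (Set.Icc (n - 1) (n + 1)) (X⟦a⟧) := by
  obtain rfl | rfl | rfl : a = -1 ∨ a = 0 ∨ a = 1 := by omega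
  · exact hG.shift_neg n X hX
  · exact (small_extRetractClosed G _).iso ((shiftFunctorZero T ℤ).symm.app X) (hG.self n X hX)
  · exact hG.shift_pos n X hX

lemma metricM_rightOrthogonal_shift_one (hG : IsGeneratingSequence G) {n a : ℤ}
    (ha : a.natAbs ≤ 1) {X : T} (hX : (metricM G n).rightOrthogonal X) :
    (metricM G (n + 1)).rightOrthogonal (X⟦a⟧) := by
  rw [metricM_rightOrthogonal_iff]
  intro j hj K hK f
  refine hom_shift_eq_zero (a := -a) (by omega) (fun g => hX g ?_) f
  refine small_mono G ?_ _ (hG.shift_small (a := -a) (by omega) hK)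
  intro x hx
  simp only [Set.mem_Icc, Set.mem_Iic] at hx ⊢
  omega

lemma metricR_shift_one (hG : IsGeneratingSequence G) {n a : ℤ} (ha : a.natAbs ≤ 1) {X : T}
    (hX : metricR G (n + 1) X) : metricR G n (X⟦a⟧) := fun _ f hY =>
  shift_hom_eq_zero (b := -a) (by omega)
    (fun g => hX g (metricM_rightOrthogonal_shift_one hG (by omega) hY)) f

lemma metricR_shift (hG : IsGeneratingSequence G) {n a m : ℤ} (h : m + |a| ≤ n) {X : T}
    (hX : metricR G n X) : metricR G m (X⟦a⟧) := by
  obtain ⟨k, hk⟩ : ∃ k : ℕ, a.natAbs = k := ⟨_, rfl⟩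
  induction k generalizing a m with
  | zero =>
    obtain rfl : a = 0 := by omega
    exact (metricR_extRetractClosed G _).iso ((shiftFunctorZero T ℤ).symm.app X)
      (metricR_anti G (by simpa using h) _ hX)
  | succ k ih =>
    obtain ⟨b, s, hs, rfl, hb⟩ : ∃ b s : ℤ, s.natAbs ≤ 1 ∧ a = b + s ∧ b.natAbs = k := by
      rcases le_total 0 a with h0 | h0
      · exact ⟨a - 1, 1, by omega, by omega, by omega⟩
      · exact ⟨a + 1, -1, by omega, by omega, by omega⟩
    have h1 : metricR G (m + 1) (X⟦b⟧) := ih (by rw [Int.abs_eq_natAbs] at h ⊢; omega) hb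
    exact (metricR_extRetractClosed G _).iso ((shiftFunctorAdd T b s).symm.app X)
      (metricR_shift_one hG hs h1)

end MetricR

end GApprox

namespace GApprox

/-! ### Compact objects -/

section Compacts

variable {T : Type u} [Category.{v} T] [HasZeroObject T] [HasShift T ℤ] [Preadditive T]
  [∀ n : ℤ, (shiftFunctor T n).Additive] [Pretriangulated T]

lemma ExtRetractClosed.shift {P : ObjectProperty T} (hP : ExtRetractClosed P) (n : ℤ) :
    ExtRetractClosed (fun X => P (X⟦n⟧)) where
  zero _ h := hP.zero _ (Functor.map_isZero _ h)
  ext h hX hZ := hP.ext (Triangle.shift_distinguished _ h n) hX hZ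
  retract r hY := hP.retract (r.map (shiftFunctor T n)) hY

lemma ExtRetractClosed.shift_iso {P : ObjectProperty T} (hP : ExtRetractClosed P) {a b c : ℤ}
    (h : a + b = c) {X : T} : P ((X⟦a⟧)⟦b⟧) ↔ P (X⟦c⟧) :=
  ⟨fun hX => hP.iso ((shiftFunctorAdd' T a b c h).symm.app X) hX,
    fun hX => hP.iso ((shiftFunctorAdd' T a b c h).app X) hX⟩

lemma ExtRetractClosed.shift_zero {P : ObjectProperty T} (hP : ExtRetractClosed P) {X : T} :
    P (X⟦(0 : ℤ)⟧) ↔ P X :=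
  ⟨fun hX => hP.iso ((shiftFunctorZero T ℤ).app X) hX,
    fun hX => hP.iso ((shiftFunctorZero T ℤ).symm.app X) hX⟩

lemma compacts_of_extRetractClosed {G : ℤ → ObjectProperty T} (hG : IsGeneratingSequence G) :
    ExtRetractClosed (compacts T) := by
  rw [← hG.generates]
  exact small_extRetractClosed G _

lemma small_le_compacts {G : ℤ → ObjectProperty T} (hG : IsGeneratingSequence G) (I : Set ℤ) :
    small G I ≤ compacts T := by
  rw [← hG.generates]
  exact small_mono G (Set.subset_univ I)

lemma compacts_shift {G : ℤ → ObjectProperty T} (hG : IsGeneratingSequence G) {X : T}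
    (hX : compacts T X) (n : ℤ) : compacts T (X⟦n⟧) := by
  have hc := compacts_of_extRetractClosed hG
  have key : ∀ a : ℤ, a.natAbs ≤ 1 → ∀ Y, compacts T Y → compacts T (Y⟦a⟧) := by
    intro a ha Y hY
    rw [← hG.generates] at hY
    refine (hc.shift a).small_le ?_ Y hY
    rintro Z ⟨m, _, hZ⟩
    exact small_le_compacts hG _ _ (hG.shift_small ha hZ)
  induction n with
  | zero => exact hc.shift_zero.2 hX
  | succ n ih => exact (hc.shift_iso rfl).1 (key 1 (by simp) _ ih)
  | pred n ih => exact (hc.shift_iso (by omega)).1 (key (-1) (by simp) _ ih)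

lemma compacts_cone {G : ℤ → ObjectProperty T} (hG : IsGeneratingSequence G) {X Y Z : T}
    {a : X ⟶ Y} {b : Y ⟶ Z} {c : Z ⟶ X⟦(1 : ℤ)⟧} (h : Triangle.mk a b c ∈ distTriang T)
    (hX : compacts T X) (hY : compacts T Y) : compacts T Z :=
  (compacts_of_extRetractClosed hG).ext (rot_of_distTriang _ h) hY (compacts_shift hG hX 1)

lemma exists_small_Icc {G : ℤ → ObjectProperty T} (hG : IsGeneratingSequence G) {X : T}
    (hX : compacts T X) : ∃ n : ℕ, small G (Set.Icc (-(n : ℤ)) n) X := by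
  rw [← hG.generates] at hX
  have mono : ∀ {m n : ℕ}, m ≤ n → small G (Set.Icc (-(m : ℤ)) m) ≤ small G (Set.Icc (-(n : ℤ)) n) :=
    fun h => small_mono G (Set.Icc_subset_Icc (by omega) (by omega))
  have hP : ExtRetractClosed (fun X => ∃ n : ℕ, small G (Set.Icc (-(n : ℤ)) n) X) :=
    { zero := fun X h => ⟨0, (small_extRetractClosed G _).zero X h⟩
      ext := by
        rintro X Y Z a b c h ⟨m, hm⟩ ⟨n, hn⟩
        exact ⟨max m n, (small_extRetractClosed G _).ext h (mono (le_max_left _ _) _ hm)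
          (mono (le_max_right _ _) _ hn)⟩
      retract := fun r ⟨n, hn⟩ => ⟨n, (small_extRetractClosed G _).retract r hn⟩ }
  refine hP.small_le ?_ X hX
  rintro Y ⟨m, _, hY⟩
  exact ⟨m.natAbs, slice_le_small G _ _ ⟨m, by simp only [Set.mem_Icc]; omega, hY⟩⟩

/-- A map from a compact object to a coproduct is a finite sum of maps to the summands. -/
lemma exists_finset_sum_of_compact {K : T} (hK : compacts T K) {X : ℕ → T} {c : Cofan X}
    (hc : IsColimit c) (f : K ⟶ c.pt) :
    ∃ (s : Finset ℕ) (g : ∀ j, K ⟶ X j), f = ∑ j ∈ s, g j ≫ c.inj j := by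
  have := hK (ULift.{v} ℕ)
  have : PreservesColimitsOfShape (Discrete ℕ) (preadditiveCoyoneda.obj (op K)) :=
    preservesColimitsOfShape_of_equiv (Discrete.equivalence Equiv.ulift.{v}) _
  have hc' := isColimitOfPreserves (preadditiveCoyoneda.obj (op K)) hc
  -- The quotient by the finite sums receives the zero map from each summand, hence from their
  -- coproduct, which is `Hom(K, c.pt)` by compactness.
  let S : AddSubgroup (K ⟶ c.pt) :=
    { carrier := {f | ∃ (s : Finset ℕ) (g : ∀ j, K ⟶ X j), f = ∑ j ∈ s, g j ≫ c.inj j}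
      zero_mem' := ⟨∅, fun _ => 0, by simp⟩
      add_mem' := by
        classical
        rintro _ _ ⟨s, g, rfl⟩ ⟨s', g', rfl⟩
        refine ⟨s ∪ s', fun j => (if j ∈ s then g j else 0) + (if j ∈ s' then g' j else 0), ?_⟩
        simp only [Preadditive.add_comp, Finset.sum_add_distrib]
        congr 1
        · rw [← Finset.sum_subset (Finset.subset_union_left (s₂ := s'))]
          · exact Finset.sum_congr rfl (fun j hj => by simp [hj])
          · intro j _ hj; simp [hj]
        · rw [← Finset.sum_subset (Finset.subset_union_right (s₁ := s))]
          · exact Finset.sum_congr rfl (fun j hj => by simp [hj])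
          · intro j _ hj; simp [hj]
      neg_mem' := by
        rintro _ ⟨s, g, rfl⟩
        exact ⟨s, fun j => - g j, by simp⟩ }
  suffices h : (AddCommGrpCat.ofHom (QuotientAddGroup.mk' S) :
      (preadditiveCoyoneda.obj (op K)).obj c.pt ⟶ AddCommGrpCat.of ((K ⟶ c.pt) ⧸ S)) = 0 by
    have h1 := congrArg (fun φ => φ.hom f) h
    exact (QuotientAddGroup.eq_zero_iff f).1 h1
  refine hc'.hom_ext (fun ⟨j⟩ => ?_)
  ext g
  let g' : K ⟶ X j := g
  refine (QuotientAddGroup.eq_zero_iff _).2 ⟨{j}, Function.update (fun _ => 0) j g', ?_⟩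
  rw [Finset.sum_singleton, Function.update_self]
  rfl

end Compacts

/-! ### Homotopy colimits of sequences -/

section Hocolim

variable {T : Type u} [Category.{v} T] [HasZeroObject T] [HasShift T ℤ] [Preadditive T]
  [∀ n : ℤ, (shiftFunctor T n).Additive] [Pretriangulated T]
  (S : ℕ ⥤ T) [HasColimitsOfShape (Discrete ℕ) T]

/-- The map `1 - shift` on the coproduct of a sequence, whose cone is the homotopy colimit. -/
noncomputable def telescope : (∐ S.obj) ⟶ (∐ S.obj) :=
  Sigma.desc (fun n => Sigma.ι S.obj n - S.map (homOfLE n.le_succ) ≫ Sigma.ι S.obj (n + 1))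

lemma ι_telescope (n : ℕ) : Sigma.ι S.obj n ≫ telescope S =
    Sigma.ι S.obj n - S.map (homOfLE n.le_succ) ≫ Sigma.ι S.obj (n + 1) := by
  simp [telescope]

lemma telescope_π_zero : telescope S ≫ Sigma.π S.obj 0 = Sigma.π S.obj 0 := by
  refine Sigma.hom_ext _ _ (fun n => ?_)
  rw [← Category.assoc, ι_telescope, Preadditive.sub_comp, Category.assoc,
    Sigma.ι_π_of_ne _ (Nat.succ_ne_zero n), comp_zero, sub_zero]

lemma telescope_π_succ (b : ℕ) : telescope S ≫ Sigma.π S.obj (b + 1) =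
    Sigma.π S.obj (b + 1) - Sigma.π S.obj b ≫ S.map (homOfLE b.le_succ) := by
  refine Sigma.hom_ext _ _ (fun n => ?_)
  rw [← Category.assoc, ι_telescope, Preadditive.sub_comp, Preadditive.comp_sub, Category.assoc]
  congr 1
  rw [← Category.assoc (Sigma.ι S.obj n)]
  by_cases h : n = b
  · subst h
    rw [Sigma.ι_π_eq_id, Sigma.ι_π_eq_id, Category.id_comp, Category.comp_id]
  · rw [Sigma.ι_π_of_ne _ h, Sigma.ι_π_of_ne _ (by omega), comp_zero, zero_comp]

/-- The components of `u` vanish recursively, starting from index `0`; by compactness `u` is a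
finite sum of its components. -/
lemma eq_zero_of_comp_telescope {K : T} (hK : compacts T K) (u : K ⟶ ∐ S.obj)
    (hu : u ≫ telescope S = 0) : u = 0 := by
  have h : ∀ b, u ≫ Sigma.π S.obj b = 0 := by
    intro b
    induction b with
    | zero => rw [← telescope_π_zero, ← Category.assoc, hu, zero_comp]
    | succ b ih =>
      have h1 : u ≫ telescope S ≫ Sigma.π S.obj (b + 1) = 0 := by
        rw [← Category.assoc, hu, zero_comp]
      rw [telescope_π_succ, Preadditive.comp_sub, ← Category.assoc, ih, zero_comp, sub_zero] at h1
      exact h1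
  obtain ⟨s, g, hg⟩ := exists_finset_sum_of_compact hK (coproductIsCoproduct S.obj) u
  have hg' : u = ∑ j ∈ s, g j ≫ Sigma.ι S.obj j := hg
  rw [hg']
  refine Finset.sum_eq_zero (fun j hj => ?_)
  have := h j
  rw [hg', Preadditive.sum_comp, Finset.sum_eq_single j] at this
  · rw [Category.assoc, Sigma.ι_π_eq_id, Category.comp_id] at this
    rw [this, zero_comp]
  · intro i _ hi
    rw [Category.assoc, Sigma.ι_π_of_ne _ hi, comp_zero]
  · exact fun h => (h hj).elim

variable {S} {F : T} {π : (∐ S.obj) ⟶ F} {δ : F ⟶ (∐ S.obj)⟦(1 : ℤ)⟧}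

lemma map_succ_hocolim (h : Triangle.mk (telescope S) π δ ∈ distTriang T) (n : ℕ) :
    S.map (homOfLE n.le_succ) ≫ Sigma.ι S.obj (n + 1) ≫ π = Sigma.ι S.obj n ≫ π := by
  have h0 : telescope S ≫ π = 0 := dist_comp₁₂ h
  have := Sigma.ι S.obj n ≫= h0
  rw [← Category.assoc, ι_telescope, Preadditive.sub_comp, comp_zero, sub_eq_zero,
    Category.assoc] at this
  exact this.symm

lemma map_hocolim (h : Triangle.mk (telescope S) π δ ∈ distTriang T) {m n : ℕ} (hmn : m ≤ n) :
    S.map (homOfLE hmn) ≫ Sigma.ι S.obj n ≫ π = Sigma.ι S.obj m ≫ π := by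
  induction n, hmn using Nat.le_induction with
  | base => simp
  | succ n hmn ih =>
    rw [← homOfLE_comp hmn n.le_succ, S.map_comp, Category.assoc, map_succ_hocolim h, ih]

lemma exists_hom_hocolim (h : Triangle.mk (telescope S) π δ ∈ distTriang T) {B : T}
    (f : ∀ n, S.obj n ⟶ B) (hf : ∀ n, S.map (homOfLE n.le_succ) ≫ f (n + 1) = f n) :
    ∃ g : F ⟶ B, ∀ n, Sigma.ι S.obj n ≫ π ≫ g = f n := by
  obtain ⟨g, hg⟩ := dist_desc₃ h (Sigma.desc f) (Sigma.hom_ext _ _ (fun n => by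
    rw [← Category.assoc, ι_telescope]
    simp [hf]))
  exact ⟨g, fun n => by rw [hg]; simp⟩

lemma factors_hocolim {G : ℤ → ObjectProperty T} (hG : IsGeneratingSequence G)
    (h : Triangle.mk (telescope S) π δ ∈ distTriang T) {K : T}
    (hK : compacts T K) (f : K ⟶ F) : ∃ (n : ℕ) (g : K ⟶ S.obj n), f = g ≫ Sigma.ι S.obj n ≫ π := by
  -- Desuspended, `f ≫ δ` is a map from a compact object killed by the telescope.
  have h1 : f ≫ δ = 0 := by
    have h2 : δ ≫ (telescope S)⟦(1 : ℤ)⟧' = 0 := dist_comp₃₁ h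
    have hK' := compacts_shift hG hK (-1)
    let e := (shiftFunctorCompIsoId T (-1 : ℤ) 1 (by omega)).app K
    obtain ⟨u, hu⟩ := (shiftFunctor T (1 : ℤ)).map_surjective (e.hom ≫ f ≫ δ)
    have hu0 : u = 0 := by
      refine eq_zero_of_comp_telescope S hK' u ((shiftFunctor T (1 : ℤ)).map_injective ?_)
      rw [Functor.map_comp, hu, Functor.map_zero, Category.assoc, Category.assoc, h2, comp_zero,
        comp_zero]
    rw [hu0, Functor.map_zero] at hu
    rw [← cancel_epi e.hom, ← hu, comp_zero]
  obtain ⟨u, hu⟩ := dist_lift₂ h f h1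
  obtain ⟨s, g, hg⟩ := exists_finset_sum_of_compact hK (coproductIsCoproduct S.obj) u
  have hg' : u = ∑ j ∈ s, g j ≫ Sigma.ι S.obj j := hg
  obtain ⟨N, hN⟩ : ∃ N : ℕ, ∀ j ∈ s, j ≤ N := ⟨s.sup id, fun j hj => Finset.le_sup (f := id) hj⟩
  refine ⟨N, ∑ j ∈ s.attach, g j.1 ≫ S.map (homOfLE (hN j.1 j.2)), ?_⟩
  rw [← hu, hg', ← Finset.sum_attach, Preadditive.sum_comp, Preadditive.sum_comp]
  refine Finset.sum_congr rfl (fun j _ => ?_)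
  rw [Category.assoc, Category.assoc, map_hocolim h]

/-- Write `g ≫ ι n = x ≫ telescope S`. The component of `x` at `b` is `0` for `b < n` and the image
of `g` for `b ≥ n`; by compactness almost all components are zero. -/
lemma eventually_zero_of_hocolim (h : Triangle.mk (telescope S) π δ ∈ distTriang T) {K : T}
    (hK : compacts T K) {n : ℕ} (g : K ⟶ S.obj n) (hg : g ≫ Sigma.ι S.obj n ≫ π = 0) :
    ∃ (m : ℕ) (hm : n ≤ m), g ≫ S.map (homOfLE hm) = 0 := by
  obtain ⟨x, hx⟩ := dist_lift₁ h (g ≫ Sigma.ι S.obj n) (by rw [Category.assoc, hg])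
  replace hx := hx.symm
  have hlow : ∀ b < n, x ≫ Sigma.π S.obj b = 0 := by
    intro b hb
    induction b with
    | zero =>
      rw [← telescope_π_zero, ← Category.assoc, ← hx, Category.assoc,
        Sigma.ι_π_of_ne _ (by omega), comp_zero]
    | succ b ih =>
      have h1 := hx =≫ Sigma.π S.obj (b + 1)
      rw [Category.assoc, Category.assoc, Sigma.ι_π_of_ne _ (by omega), comp_zero,
        telescope_π_succ, Preadditive.comp_sub, ← Category.assoc x (Sigma.π S.obj b),
        ih (by omega), zero_comp, sub_zero] at h1
      exact h1.symm
  have hhigh : ∀ b (hb : n ≤ b), x ≫ Sigma.π S.obj b = g ≫ S.map (homOfLE hb) := by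
    intro b hb
    induction b, hb using Nat.le_induction with
    | base =>
      have h1 := hx =≫ Sigma.π S.obj n
      rw [Category.assoc, Sigma.ι_π_eq_id, Category.comp_id, Category.assoc] at h1
      cases n with
      | zero => rw [telescope_π_zero] at h1; rw [← h1]; simp
      | succ k =>
        rw [telescope_π_succ, Preadditive.comp_sub, ← Category.assoc x (Sigma.π S.obj k),
          hlow k (by omega), zero_comp, sub_zero] at h1
        rw [← h1]; simp
    | succ b hb ih =>
      have h1 := hx =≫ Sigma.π S.obj (b + 1)
      rw [Category.assoc, Category.assoc, Sigma.ι_π_of_ne _ (by omega), comp_zero,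
        telescope_π_succ, Preadditive.comp_sub, ← Category.assoc x (Sigma.π S.obj b), ih] at h1
      rw [← homOfLE_comp hb b.le_succ, S.map_comp, ← Category.assoc]
      exact (sub_eq_zero.1 h1.symm)
  obtain ⟨s, y, hy⟩ := exists_finset_sum_of_compact hK (coproductIsCoproduct S.obj) x
  have hy' : x = ∑ j ∈ s, y j ≫ Sigma.ι S.obj j := hy
  obtain ⟨N, hN⟩ : ∃ N : ℕ, ∀ j ∈ s, j ≤ N := ⟨s.sup id, fun j hj => Finset.le_sup (f := id) hj⟩
  refine ⟨max n (N + 1), le_max_left _ _, ?_⟩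
  rw [← hhigh, hy', Preadditive.sum_comp]
  refine Finset.sum_eq_zero (fun j hj => ?_)
  have := hN j hj
  rw [Category.assoc, Sigma.ι_π_of_ne _ (by omega), comp_zero]

end Hocolim

end GApprox

namespace GApprox

/-! ### Torsion pairs generated by compact objects -/

section Torsion

variable {T : Type u} [Category.{v} T] [HasZeroObject T] [HasShift T ℤ] [Preadditive T]
  [∀ n : ℤ, (shiftFunctor T n).Additive] [Pretriangulated T]

lemma hasCoproducts_nat (hT : HasCoproducts.{v} T) : HasColimitsOfShape (Discrete ℕ) T :=
  have := hT (ULift.{v} ℕ)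
  hasColimitsOfShape_of_equivalence (Discrete.equivalence Equiv.ulift.{v})

/-- `Y'` is the cone of the universal map from a coproduct of the `x i`. The last clause holds
although nothing is assumed about maps `x i ⟶ B⟦1⟧`: a map to `B⟦1⟧` killed by `t` comes from the
suspended coproduct, and so desuspends. -/
lemma exists_kill_family (hT : HasCoproducts.{v} T) {I : Type v} (x : I → T) (Y : T) :
    ∃ (Y' : T) (t : Y ⟶ Y'), (∀ i (f : x i ⟶ Y), f ≫ t = 0) ∧
      ∀ B : T, (∀ i (f : x i ⟶ B), f = 0) →
        (∀ f : Y ⟶ B, ∃ g : Y' ⟶ B, t ≫ g = f) ∧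
        (∀ g : Y' ⟶ B⟦(1 : ℤ)⟧, t ≫ g = 0 → g = 0) := by
  have := hT (Σ i, (x i ⟶ Y))
  let p : (∐ fun j : Σ i, (x i ⟶ Y) => x j.1) ⟶ Y := Sigma.desc (fun j => j.2)
  obtain ⟨Y', t, d, h⟩ := distinguished_cocone_triangle p
  refine ⟨Y', t, fun i f => ?_, fun B hB => ?_⟩
  · have h1 : Sigma.ι (fun j : Σ i, (x i ⟶ Y) => x j.1) ⟨i, f⟩ ≫ p = f := by simp [p]
    rw [← h1, Category.assoc, dist_comp₁₂ h, comp_zero]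
  · have hV : ∀ f : (∐ fun j : Σ i, (x i ⟶ Y) => x j.1) ⟶ B, f = 0 := fun f =>
      Sigma.hom_ext _ _ (fun j => by rw [comp_zero]; exact hB _ _)
    refine ⟨fun f => dist_desc₃ h f (hV _), fun g hg => ?_⟩
    obtain ⟨k, rfl⟩ := dist_desc₄ h g hg
    obtain ⟨k', rfl⟩ := (shiftFunctor T (1 : ℤ)).map_surjective k
    rw [hV k', Functor.map_zero, comp_zero]

lemma exists_sequence {P : ∀ ⦃X Y : T⦄, (X ⟶ Y) → Prop} (hP : ∀ X, ∃ (Y : T) (t : X ⟶ Y), P t)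
    (X₀ : T) : ∃ S : ℕ ⥤ T, S.obj 0 = X₀ ∧ ∀ n : ℕ, P (S.map (homOfLE n.le_succ)) := by
  choose Y t ht using hP
  let obj : ℕ → T := fun n => Nat.rec X₀ (fun _ Z => Y Z) n
  refine ⟨Functor.ofSequence (X := obj) (fun n => t (obj n)), rfl, fun n => ?_⟩
  erw [Functor.ofSequence_map_homOfLE_succ]
  exact ht _

/-- A family of compact objects generates a torsion pair. -/
theorem exists_torsion_triangle {G : ℤ → ObjectProperty T} (hG : IsGeneratingSequence G)
    (hT : HasCoproducts.{v} T) {I : Type v} (x : I → T) (hx : ∀ i, compacts T (x i)) (Y₀ : T) :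
    ∃ (X Y : T) (a : X ⟶ Y₀) (b : Y₀ ⟶ Y) (c : Y ⟶ X⟦(1 : ℤ)⟧),
      Triangle.mk a b c ∈ distTriang T ∧ (∀ i (f : x i ⟶ Y), f = 0) ∧
      ∀ B : T, (∀ i (f : x i ⟶ B), f = 0) → ∀ f : X ⟶ B, f = 0 := by
  have := hasCoproducts_nat hT
  obtain ⟨S, rfl, hS⟩ := exists_sequence (exists_kill_family hT x) Y₀
  obtain ⟨Y, π, δ, h⟩ := distinguished_cocone_triangle (telescope S)
  let b : S.obj 0 ⟶ Y := Sigma.ι S.obj 0 ≫ π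
  obtain ⟨X, a, c, hX⟩ := distinguished_cocone_triangle₁ b
  refine ⟨X, Y, a, b, c, hX, fun i f => ?_, fun B hB f => ?_⟩
  · obtain ⟨n, g, rfl⟩ := factors_hocolim hG h (hx i) f
    rw [← map_succ_hocolim h, ← Category.assoc, (hS n).1, zero_comp]
  have surj : ∀ f : S.obj 0 ⟶ B, ∃ g : Y ⟶ B, b ≫ g = f := by
    intro f
    choose e he using fun n => ((hS n).2 B hB).1
    let φ : ∀ n, S.obj n ⟶ B := fun n =>
      Nat.rec (motive := fun n => S.obj n ⟶ B) f (fun k g => e k g) n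
    obtain ⟨g, hg⟩ := exists_hom_hocolim h (B := B) φ (fun n => he _ _)
    exact ⟨g, by simpa [b, φ] using hg 0⟩
  have inj : ∀ g : Y ⟶ B⟦(1 : ℤ)⟧, b ≫ g = 0 → g = 0 := by
    intro g hg
    have h0 : ∀ n, Sigma.ι S.obj n ≫ π ≫ g = 0 := by
      intro n
      induction n with
      | zero => rw [← Category.assoc]; exact hg
      | succ n ih =>
        refine ((hS n).2 B hB).2 _ ?_
        refine Eq.trans ?_ ih
        rw [← Category.assoc (Sigma.ι S.obj n), ← map_succ_hocolim h n, Category.assoc,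
          Category.assoc]
    have h1 : π ≫ g = 0 := Sigma.hom_ext _ _ (fun n => by rw [h0, comp_zero])
    obtain ⟨k, rfl⟩ := dist_desc₄ h g h1
    obtain ⟨k, rfl⟩ := (shiftFunctor T (1 : ℤ)).map_surjective k
    choose e he using fun n => ((hS n).2 B hB).1
    -- Vanishing of `lim¹`: restriction along `S n ⟶ S (n + 1)` is surjective on maps to `B`, so the
    -- equations expressing that `k` factors through the telescope are solved recursively.
    let φ : ∀ n, S.obj n ⟶ B := fun n => Nat.rec (motive := fun n => S.obj n ⟶ B) 0
      (fun n g => e n (g - Sigma.ι S.obj n ≫ k)) n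
    have hφ : ∀ n, S.map (homOfLE n.le_succ) ≫ φ (n + 1) = φ n - Sigma.ι S.obj n ≫ k := fun n =>
      he _ _
    have hk : telescope S ≫ Sigma.desc φ = k := by
      refine Sigma.hom_ext _ _ (fun n => ?_)
      rw [← Category.assoc, ι_telescope, Preadditive.sub_comp, Category.assoc, Sigma.ι_desc,
        Sigma.ι_desc, hφ]
      simp
    rw [← hk, Functor.map_comp, ← Category.assoc, dist_comp₃₁ h, zero_comp]
  obtain ⟨g, hg⟩ : ∃ g : S.obj 0 ⟶ B, a ≫ g = f := by
    have h2 : c ≫ f⟦(1 : ℤ)⟧' = 0 := inj _ (by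
      rw [← Category.assoc, dist_comp₂₃ hX, zero_comp])
    obtain ⟨g, hg⟩ := dist_desc₃ (dist_rotate (dist_rotate hX)) (f⟦(1 : ℤ)⟧') h2
    obtain ⟨g, rfl⟩ := (shiftFunctor T (1 : ℤ)).map_surjective g
    refine ⟨-g, (shiftFunctor T (1 : ℤ)).map_injective ?_⟩
    rw [← hg]
    simp
  obtain ⟨k, rfl⟩ := surj g
  rw [← hg, ← Category.assoc, dist_comp₁₂ hX, zero_comp]

theorem exists_metric_torsion_triangle {G : ℤ → ObjectProperty T}
    (hG : IsFiniteGeneratingSequence G) (hT : HasCoproducts.{v} T) (n : ℤ) (Y₀ : T) :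
    ∃ (X Y : T) (a : X ⟶ Y₀) (b : Y₀ ⟶ Y) (c : Y ⟶ X⟦(1 : ℤ)⟧),
      Triangle.mk a b c ∈ distTriang T ∧ metricR G n X ∧ (metricM G n).rightOrthogonal Y := by
  -- Finiteness of each `𝒢ʲ` makes the generators a countable, hence small, family.
  have hc : Set.Countable {X : T | slice G (Set.Iic (-n)) X} := by
    have : {X : T | slice G (Set.Iic (-n)) X} = ⋃ j ∈ Set.Iic (-n), {X : T | G j X} := by
      ext X; simp [slice]
    rw [this]
    exact Set.Countable.biUnion (Set.to_countable _) (fun j _ => (hG.finite j).countable)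
  have : Countable {X : T // slice G (Set.Iic (-n)) X} := hc.to_subtype
  let I := Shrink.{v} {X : T // slice G (Set.Iic (-n)) X}
  let x : I → T := fun i => ((equivShrink.{v} _).symm i).1
  have hx : ∀ B : T, (∀ i (f : x i ⟶ B), f = 0) ↔ (metricM G n).rightOrthogonal B := by
    intro B
    rw [metricM_rightOrthogonal_iff]
    constructor
    · intro h j hj K hK f
      obtain ⟨i, hi⟩ := (equivShrink.{v} {X : T // slice G (Set.Iic (-n)) X}).symm.surjective
        ⟨K, j, hj, hK⟩
      have hi' : x i = K := congrArg Subtype.val hi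
      subst hi'
      exact h i f
    · intro h i f
      obtain ⟨j, hj, hK⟩ := ((equivShrink.{v} {X : T // slice G (Set.Iic (-n)) X}).symm i).2
      exact h j hj _ hK f
  obtain ⟨X, Y, a, b, c, h, hY, hX⟩ := exists_torsion_triangle hG.toIsGeneratingSequence hT x
    (fun i => by
      obtain ⟨j, hj, hK⟩ := ((equivShrink.{v} {X : T // slice G (Set.Iic (-n)) X}).symm i).2
      exact hG.le_compacts j _ hK) Y₀
  exact ⟨X, Y, a, b, c, h, fun B f hB => hX B ((hx B).2 hB) f, (hx Y).1 hY⟩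

end Torsion

end GApprox

namespace GApprox

/-! ### Consequences of the octahedral axiom -/

section Octahedra

variable {T : Type u} [Category.{v} T] [HasZeroObject T] [HasShift T ℤ] [Preadditive T]
  [∀ n : ℤ, (shiftFunctor T n).Additive] [Pretriangulated T] [IsTriangulated T]

/-- The cone of a composite is an extension of the cones. -/
lemma exists_cone_comp {X₁ X₂ X₃ Z₁₂ Z₂₃ : T} {f : X₁ ⟶ X₂} {v₁₂ : X₂ ⟶ Z₁₂}
    {w₁₂ : Z₁₂ ⟶ X₁⟦(1 : ℤ)⟧} (h₁₂ : Triangle.mk f v₁₂ w₁₂ ∈ distTriang T)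
    {g : X₂ ⟶ X₃} {v₂₃ : X₃ ⟶ Z₂₃} {w₂₃ : Z₂₃ ⟶ X₂⟦(1 : ℤ)⟧}
    (h₂₃ : Triangle.mk g v₂₃ w₂₃ ∈ distTriang T) :
    ∃ (Z : T) (b : X₃ ⟶ Z) (c : Z ⟶ X₁⟦(1 : ℤ)⟧) (p : Z₁₂ ⟶ Z) (q : Z ⟶ Z₂₃),
      Triangle.mk (f ≫ g) b c ∈ distTriang T ∧
      Triangle.mk p q (w₂₃ ≫ v₁₂⟦(1 : ℤ)⟧') ∈ distTriang T := by
  obtain ⟨Z, b, c, h⟩ := distinguished_cocone_triangle (f ≫ g)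
  let o := Triangulated.someOctahedron rfl h₁₂ h₂₃ h
  exact ⟨Z, b, c, o.m₁, o.m₃, h, o.mem⟩

/-- The fibre of a composite is an extension of the fibres. -/
lemma exists_fibre_comp {X₁ X₂ X₃ Z₁₂ Z₂₃ : T} {v₁₂ : Z₁₂ ⟶ X₁} {f : X₁ ⟶ X₂}
    {w₁₂ : X₂ ⟶ Z₁₂⟦(1 : ℤ)⟧} (h₁₂ : Triangle.mk v₁₂ f w₁₂ ∈ distTriang T)
    {v₂₃ : Z₂₃ ⟶ X₂} {g : X₂ ⟶ X₃} {w₂₃ : X₃ ⟶ Z₂₃⟦(1 : ℤ)⟧}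
    (h₂₃ : Triangle.mk v₂₃ g w₂₃ ∈ distTriang T) :
    ∃ (Z : T) (a : Z ⟶ X₁) (c : X₃ ⟶ Z⟦(1 : ℤ)⟧) (p : Z₁₂ ⟶ Z) (q : Z ⟶ Z₂₃),
      Triangle.mk a (f ≫ g) c ∈ distTriang T ∧
      Triangle.mk p q (v₂₃ ≫ w₁₂) ∈ distTriang T ∧ p ≫ a = v₁₂ := by
  obtain ⟨Z, a, c, h⟩ := distinguished_cocone_triangle₁ (f ≫ g)
  let o := Triangulated.someOctahedron' rfl h₁₂ h₂₃ h
  exact ⟨Z, a, c, o.m₁, o.m₃, h, o.mem, o.comm₁⟩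

/-- A weak 3×3 lemma. The two factorizations of `E₁ ⟶ Y` put its cone `V` in triangles `E₃ ⟶ V ⟶ D₂`
and `D₁ ⟶ V ⟶ Z`; then `i₃` is the composite `E₃ ⟶ V ⟶ Z`. -/
lemma exists_cone_map {E₁ E₂ E₃ X Y Z D₁ D₂ : T} {e : E₁ ⟶ E₂} {e' : E₂ ⟶ E₃}
    {e'' : E₃ ⟶ E₁⟦(1 : ℤ)⟧} (hE : Triangle.mk e e' e'' ∈ distTriang T)
    {a : X ⟶ Y} {b : Y ⟶ Z} {c : Z ⟶ X⟦(1 : ℤ)⟧} (hX : Triangle.mk a b c ∈ distTriang T)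
    {i₁ : E₁ ⟶ X} {p₁ : X ⟶ D₁} {q₁ : D₁ ⟶ E₁⟦(1 : ℤ)⟧} (h₁ : Triangle.mk i₁ p₁ q₁ ∈ distTriang T)
    {i₂ : E₂ ⟶ Y} {p₂ : Y ⟶ D₂} {q₂ : D₂ ⟶ E₂⟦(1 : ℤ)⟧} (h₂ : Triangle.mk i₂ p₂ q₂ ∈ distTriang T)
    (comm : e ≫ i₂ = i₁ ≫ a) :
    ∃ (D₃ : T) (i₃ : E₃ ⟶ Z) (p₃ : Z ⟶ D₃) (q₃ : D₃ ⟶ E₃⟦(1 : ℤ)⟧) (r : D₂ ⟶ D₃)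
      (s : D₃ ⟶ D₁⟦(1 : ℤ)⟧) (t : D₁⟦(1 : ℤ)⟧ ⟶ D₂⟦(1 : ℤ)⟧),
      Triangle.mk i₃ p₃ q₃ ∈ distTriang T ∧ Triangle.mk r s t ∈ distTriang T := by
  obtain ⟨V, b', c', hV⟩ := distinguished_cocone_triangle (e ≫ i₂)
  let o₁ := Triangulated.someOctahedron rfl hE h₂ hV
  let o₂ := Triangulated.someOctahedron comm.symm h₁ hX hV
  obtain ⟨D₃, p₃, q₃, r, s, h3, h4⟩ := exists_cone_comp o₁.mem (dist_rotate o₂.mem)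
  exact ⟨D₃, _, p₃, q₃, r, s, _, h3, h4⟩

end Octahedra

/-! ### Finitely generated Hom modules -/

section FiniteHom

variable {T : Type u} [Category.{v} T] [HasZeroObject T] [HasShift T ℤ] [Preadditive T]
  [∀ n : ℤ, (shiftFunctor T n).Additive] [Pretriangulated T]
  (R : Type w) [CommRing R] [IsNoetherianRing R] [Linear R T]

lemma finite_hom_target_extRetractClosed (W : T) :
    ExtRetractClosed (fun Y : T => Module.Finite R (W ⟶ Y)) where
  zero X h := by
    have : Subsingleton (W ⟶ X) := ⟨fun f g => h.eq_of_tgt _ _⟩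
    infer_instance
  ext {X Y Z a b c} h hX hZ := by
    have : IsNoetherian R (W ⟶ Y) :=
      isNoetherian_of_range_eq_ker (Linear.rightComp R W a) (Linear.rightComp R W b) (by
        ext f
        simp only [LinearMap.mem_range, LinearMap.mem_ker, Linear.rightComp_apply]
        constructor
        · rintro ⟨g, rfl⟩
          rw [Category.assoc, dist_comp₁₂ h, comp_zero]
        · exact dist_lift₁ h f)
    infer_instance
  retract {X Y} r hY := by
    refine Module.Finite.of_injective (Linear.rightComp R W r.i) (fun f g hfg => ?_)
    have := congrArg (· ≫ r.r) hfg
    simpa using this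

lemma finite_hom_source_extRetractClosed (W : T) :
    ExtRetractClosed (fun Y : T => Module.Finite R (Y ⟶ W)) where
  zero X h := by
    have : Subsingleton (X ⟶ W) := ⟨fun f g => h.eq_of_src _ _⟩
    infer_instance
  ext {X Y Z a b c} h hX hZ := by
    have : IsNoetherian R (Y ⟶ W) :=
      isNoetherian_of_range_eq_ker (Linear.leftComp R W b) (Linear.leftComp R W a) (by
        ext f
        simp only [LinearMap.mem_range, LinearMap.mem_ker, Linear.leftComp_apply]
        constructor
        · rintro ⟨g, rfl⟩
          rw [← Category.assoc, dist_comp₁₂ h, zero_comp]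
        · exact dist_desc₃ h f)
    infer_instance
  retract {X Y} r hY := by
    refine Module.Finite.of_injective (Linear.leftComp R W r.r) (fun f g hfg => ?_)
    have := congrArg (r.i ≫ ·) hfg
    simpa using this

/-- The objects `X` such that `Hom(K, X)` is finitely generated for all compact `K`. -/
def FiniteHoms : ObjectProperty T := fun X => ∀ K : T, compacts T K → Module.Finite R (K ⟶ X)

lemma finiteHoms_extRetractClosed : ExtRetractClosed (FiniteHoms R : ObjectProperty T) where
  zero X h K _ := (finite_hom_target_extRetractClosed R K).zero X h
  ext h hX hZ K hK := (finite_hom_target_extRetractClosed R K).ext h (hX K hK) (hZ K hK)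
  retract r hY K hK := (finite_hom_target_extRetractClosed R K).retract r (hY K hK)

lemma compacts_le_finiteHoms {G : ℤ → ObjectProperty T} (hG : IsGeneratingSequence G)
    (hfin : ∀ (m n : ℤ) (X Y : T), G m X → G n Y → Module.Finite R (X ⟶ Y)) :
    compacts T ≤ FiniteHoms R := by
  intro X hX K hK
  rw [← hG.generates] at hX hK
  refine (finite_hom_target_extRetractClosed R K).small_le (fun Y ⟨n, _, hY⟩ => ?_) X hX
  exact (finite_hom_source_extRetractClosed R Y).small_le
    (fun Z ⟨m, _, hZ⟩ => hfin m n Z Y hZ hY) K hK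

end FiniteHom

/-! ### Covers by compact objects -/

section Cover

variable {T : Type u} [Category.{v} T] [HasZeroObject T] [HasShift T ℤ] [Preadditive T]
  [∀ n : ℤ, (shiftFunctor T n).Additive] [Pretriangulated T]
  {R : Type w} [CommRing R] [Linear R T]

lemma coprod_biprod {U : ObjectProperty T} {X Y : T} (hX : coprod U X) (hY : coprod U Y) :
    coprod U (X ⊞ Y) :=
  .ext _ _ _ _ _ _ (binaryBiproductTriangle_distinguished X Y) hX hY

variable (H : (compacts T).FullSubcategoryᵒᵖ ⥤ ModuleCat.{v} R)

/-- Finitely many elements of an additive functor on the compact objects are restrictions of one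
element. -/
lemma exists_cover_of_finite (hc : ExtRetractClosed (compacts T)) (hadd : H.Additive)
    (N : ∀ X, Submodule R (H.obj (op X)))
    (hN : ∀ {X Y : (compacts T).FullSubcategory} (s : X ⟶ Y), ∀ y ∈ N Y, (H.map s.op).hom y ∈ N X)
    (U : ObjectProperty T) (s : Set (Σ X : (compacts T).FullSubcategory, H.obj (op X)))
    (hs : s.Finite) (hU : ∀ p ∈ s, U p.1.obj) (hsN : ∀ p ∈ s, p.2 ∈ N p.1) :
    ∃ (K : (compacts T).FullSubcategory) (y : H.obj (op K)), coprod U K.obj ∧ y ∈ N K ∧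
      ∀ p ∈ s, ∃ t : p.1 ⟶ K, (H.map t.op).hom y = p.2 := by
  induction s, hs using Set.Finite.induction_on with
  | empty =>
    exact ⟨⟨_, hc.zero _ (isZero_zero T)⟩, 0, coprod_zero U _ (isZero_zero T), zero_mem _, by simp⟩
  | @insert p s _ _ ih =>
    obtain ⟨K, y, hK, hy, ht⟩ := ih (fun q hq => hU q (by simp [hq])) (fun q hq => hsN q (by simp [hq]))
    let X := p.1
    let L : (compacts T).FullSubcategory := ⟨K.obj ⊞ X.obj, hc.biprod K.2 X.2⟩
    let fst : L ⟶ K := ObjectProperty.homMk biprod.fst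
    let snd : L ⟶ X := ObjectProperty.homMk biprod.snd
    let inl : K ⟶ L := ObjectProperty.homMk biprod.inl
    let inr : X ⟶ L := ObjectProperty.homMk biprod.inr
    have h1 : inl ≫ fst = 𝟙 K := by ext; simp [inl, fst]
    have h2 : inl ≫ snd = 0 := by ext; simp [inl, snd]
    have h3 : inr ≫ fst = 0 := by ext; simp [inr, fst]
    have h4 : inr ≫ snd = 𝟙 X := by ext; simp [inr, snd]
    have cmp : ∀ {A B C : (compacts T).FullSubcategory} (f : A ⟶ B) (g : B ⟶ C) (z : H.obj (op C)),
        (H.map f.op).hom ((H.map g.op).hom z) = (H.map (f ≫ g).op).hom z := by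
      intro A B C f g z
      rw [op_comp, H.map_comp]; rfl
    have hz : ∀ {A B : (compacts T).FullSubcategory} (z : H.obj (op B)),
        (H.map (0 : A ⟶ B).op).hom z = 0 := by
      intro A B z
      rw [op_zero, H.map_zero]; rfl
    have hi : ∀ {A : (compacts T).FullSubcategory} (z : H.obj (op A)),
        (H.map (𝟙 A).op).hom z = z := by
      intro A z
      rw [op_id, H.map_id]; rfl
    refine ⟨L, (H.map fst.op).hom y + (H.map snd.op).hom p.2,
      coprod_biprod hK (.of _ (hU p (by simp))),
      add_mem (hN _ _ hy) (hN _ _ (hsN p (by simp))), ?_⟩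
    intro q hq
    rcases Set.mem_insert_iff.1 hq with rfl | hq
    · refine ⟨inr, ?_⟩
      rw [map_add, cmp, cmp, h3, h4, hz, hi, zero_add]
    · obtain ⟨t, ht⟩ := ht q hq
      refine ⟨t ≫ inl, ?_⟩
      rw [map_add, cmp, cmp, Category.assoc, Category.assoc, h1, h2, comp_zero, hz, add_zero,
        Category.comp_id, ht]

/-- The elements of `H(X)` induced by `y` form a submodule, so it suffices to reach generators. The
subfunctor `N` is there for two uses: all of `H`, and the kernel of a map `Hom(-, B) ⟶ H`. -/
lemma exists_cover (hc : ExtRetractClosed (compacts T)) (hadd : H.Additive)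
    (hsmul : ∀ {K L : (compacts T).FullSubcategory} (f : K ⟶ L) (r : R),
      H.map (r • f).op = r • H.map f.op)
    (N : ∀ X, Submodule R (H.obj (op X)))
    (hN : ∀ {X Y : (compacts T).FullSubcategory} (s : X ⟶ Y), ∀ y ∈ N Y, (H.map s.op).hom y ∈ N X)
    (U : ObjectProperty T) (hU : Set.Finite {X | U X})
    (hfg : ∀ X : (compacts T).FullSubcategory, U X.obj → (N X).FG) :
    ∃ (K : (compacts T).FullSubcategory) (y : H.obj (op K)), coprod U K.obj ∧ y ∈ N K ∧
      ∀ X : (compacts T).FullSubcategory, U X.obj → ∀ x ∈ N X,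
        ∃ t : X ⟶ K, (H.map t.op).hom y = x := by
  have hU' : Set.Finite {X : (compacts T).FullSubcategory | U X.obj} :=
    hU.preimage (f := fun X : (compacts T).FullSubcategory => X.obj)
      (fun X _ Y _ h => by cases X; cases Y; cases h; rfl)
  choose! S hS using hfg
  let s : Set (Σ X : (compacts T).FullSubcategory, H.obj (op X)) :=
    ⋃ X ∈ {X : (compacts T).FullSubcategory | U X.obj}, (Sigma.mk X) '' (S X : Set (H.obj (op X)))
  have hs : s.Finite := hU'.biUnion (fun X _ => (S X).finite_toSet.image _)
  have mem : ∀ p ∈ s, U p.1.obj ∧ p.2 ∈ S p.1 := by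
    intro p hp
    simp only [s, Set.mem_iUnion, Set.mem_image] at hp
    obtain ⟨X, hX, x, hx, rfl⟩ := hp
    exact ⟨hX, hx⟩
  obtain ⟨K, y, hK, hy, ht⟩ := exists_cover_of_finite H hc hadd N hN U s hs (fun p hp => (mem p hp).1)
    (fun p hp => by
      rw [← hS p.1 (mem p hp).1]
      exact Submodule.subset_span (mem p hp).2)
  refine ⟨K, y, hK, hy, fun X hX x hx => ?_⟩
  let C : Submodule R (H.obj (op X)) :=
    { carrier := {x | ∃ t : X ⟶ K, (H.map t.op).hom y = x}
      zero_mem' := ⟨0, by rw [op_zero, H.map_zero]; rfl⟩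
      add_mem' := by
        rintro _ _ ⟨t, rfl⟩ ⟨t', rfl⟩
        exact ⟨t + t', by rw [op_add, H.map_add]; rfl⟩
      smul_mem' := by
        rintro r _ ⟨t, rfl⟩
        exact ⟨r • t, by rw [hsmul]; rfl⟩ }
  have : N X ≤ C := by
    rw [← hS X hX, Submodule.span_le]
    intro x hx
    exact ht ⟨X, x⟩ (by
      simp only [s, Set.mem_iUnion, Set.mem_image]
      exact ⟨X, hX, x, hx, rfl⟩)
  exact this hx

lemma restrictedYoneda_additive (C : T) : ((restrictedYoneda T R).obj C).Additive where
  map_add {X Y f g} := by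
    ext h
    exact Preadditive.add_comp _ _ _ _ _ _

lemma restrictedYoneda_map_smul (C : T) {K L : (compacts T).FullSubcategory} (f : K ⟶ L) (r : R) :
    ((restrictedYoneda T R).obj C).map (r • f).op = r • ((restrictedYoneda T R).obj C).map f.op := by
  ext h
  exact Linear.smul_comp _ _ _ _ _ _

lemma exists_hom_cover (hc : ExtRetractClosed (compacts T)) [IsNoetherianRing R]
    (U : ObjectProperty T) (hU : Set.Finite {X | U X}) (hUc : U ≤ compacts T)
    (C : T) (hC : FiniteHoms R C) :
    ∃ (K : T) (k : K ⟶ C), coprod U K ∧ ∀ X, U X → ∀ f : X ⟶ C, ∃ t : X ⟶ K, t ≫ k = f := by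
  obtain ⟨K, y, hK, -, ht⟩ := exists_cover ((restrictedYoneda T R).obj C) hc
    (restrictedYoneda_additive C) (restrictedYoneda_map_smul C) (fun _ => ⊤) (by simp) U hU
    (fun X _ => (hC X.obj X.2).fg_top)
  refine ⟨K.obj, y, hK, fun X hX f => ?_⟩
  obtain ⟨t, ht⟩ := ht ⟨X, hUc X hX⟩ hX f trivial
  exact ⟨t.hom, ht⟩

end Cover

/-! ### From big approximations to small ones -/

section BigSmall

variable {T : Type u} [Category.{v} T] [HasZeroObject T] [HasShift T ℤ] [Preadditive T]
  [∀ n : ℤ, (shiftFunctor T n).Additive] [Pretriangulated T] [IsTriangulated T]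
  (R : Type w) [CommRing R] [IsNoetherianRing R] [Linear R T]

lemma coprod_le_compacts {G : ℤ → ObjectProperty T} (hG : IsGeneratingSequence G)
    {U : ObjectProperty T} (hU : U ≤ compacts T) : coprod U ≤ compacts T :=
  (compacts_of_extRetractClosed hG).coprod_le hU

lemma finiteHoms_cone {G : ℤ → ObjectProperty T} (hG : IsGeneratingSequence G)
    (hfin : compacts T ≤ FiniteHoms R) {K C C' : T} {a : K ⟶ C} {b : C ⟶ C'}
    {c : C' ⟶ K⟦(1 : ℤ)⟧} (h : Triangle.mk a b c ∈ distTriang T) (hK : compacts T K)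
    (hC : FiniteHoms R C) : FiniteHoms R C' :=
  (finiteHoms_extRetractClosed R).ext (dist_rotate h) hC (hfin _ (compacts_shift hG hK 1))

/-- A map from an object of `Coprod_{n+1}(U)` to an object with finitely generated `Hom`s factors
through an object of `coprod(U)`. -/
lemma bigCoprod_factors {G : ℤ → ObjectProperty T} (hG : IsGeneratingSequence G)
    (hfin : compacts T ≤ FiniteHoms R) (U : ObjectProperty T) (hU : Set.Finite {X | U X})
    (hUc : U ≤ compacts T) (n : ℕ) {X C : T} (hX : (bigAdd U).extensionProductIter n X)
    (hC : FiniteHoms R C) (f : X ⟶ C) :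
    ∃ (K : T) (p : X ⟶ K) (k : K ⟶ C), coprod U K ∧ p ≫ k = f := by
  have base : ∀ {X C : T}, bigAdd U X → FiniteHoms R C → ∀ f : X ⟶ C,
      ∃ (K : T) (p : X ⟶ K) (k : K ⟶ C), coprod U K ∧ p ≫ k = f := by
    rintro X C ⟨J, ⟨p⟩⟩ hC f
    obtain ⟨K, k, hK, ht⟩ := exists_hom_cover (compacts_of_extRetractClosed hG) U hU hUc C hC
    choose t ht using fun j => ht _ (p.prop_diag_obj j) (p.ι.app j ≫ f)
    refine ⟨K, p.isColimit.desc (Cocone.mk K (Discrete.natTrans (fun j => t j))), k, hK, ?_⟩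
    refine p.isColimit.hom_ext (fun j => ?_)
    rw [← Category.assoc, p.isColimit.fac]
    exact ht j
  induction n generalizing X C with
  | zero => exact base hX hC f
  | succ n ih =>
    rw [ObjectProperty.extensionProductIter_succ] at hX
    obtain ⟨X', X'', i, j, d, hT, hX', hX''⟩ := hX
    -- Treat `X'` first, then the induced map from `X''` to the cone of `k'`. The fibre of `C ⟶ C' ⟶
    -- C''` is an extension of `K''` by `K'`, and `f` lifts to it.
    obtain ⟨K', p', k', hK', hp'⟩ := base hX' hC (i ≫ f)
    obtain ⟨C', c', d', hC'⟩ := distinguished_cocone_triangle k'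
    obtain ⟨f'', hf''⟩ := dist_desc₃ hT (f ≫ c') (by
      rw [← Category.assoc, ← hp', Category.assoc, dist_comp₁₂ hC', comp_zero])
    obtain ⟨K'', p'', k'', hK'', hp''⟩ := ih hX''
      (finiteHoms_cone R hG hfin hC' (coprod_le_compacts hG hUc _ hK') hC) f''
    obtain ⟨C'', c'', d'', hC''⟩ := distinguished_cocone_triangle k''
    obtain ⟨K, k, e, p, q, h1, h2, h3⟩ := exists_fibre_comp hC' hC''
    obtain ⟨l, hl⟩ := dist_lift₁ h1 f (by
      rw [← Category.assoc, ← hf'', ← hp'', Category.assoc, Category.assoc, dist_comp₁₂ hC'',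
        comp_zero, comp_zero])
    exact ⟨K, l, k, .ext _ _ _ _ _ _ h2 hK' hK'', hl⟩

/-- `E` is a retract of a big `X`; the retraction `X ⟶ E` factors through an object of `coprod`, of
which `E` is then a retract as well. -/
lemma small_of_big {G : ℤ → ObjectProperty T} (hG : IsFiniteGeneratingSequence G)
    (hfin : compacts T ≤ FiniteHoms R) {I : Set ℤ} (hI : I.Finite) {n : ℕ} {E : T}
    (hE : big G I n E) (hE' : FiniteHoms R E) : small G I E := by
  obtain ⟨X, hX, ⟨r⟩⟩ := hE
  have hU : Set.Finite {X | slice G I X} := by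
    have : {X : T | slice G I X} = ⋃ j ∈ I, {X : T | G j X} := by
      ext X; simp [slice]
    rw [this]
    exact hI.biUnion (fun j _ => hG.finite j)
  obtain ⟨K, p, k, hK, hp⟩ := bigCoprod_factors R hG.toIsGeneratingSequence hfin (slice G I) hU
    (fun X ⟨n, _, hX⟩ => hG.le_compacts n X hX) (n - 1) hX hE' r.r
  exact ⟨K, hK, ⟨⟨r.i ≫ p, k, by rw [Category.assoc, hp, r.retract]⟩⟩⟩

end BigSmall

end GApprox

namespace GApprox

/-! ### Ghost maps and ghost length -/

section Ghosts

variable {T : Type u} [Category.{v} T] [HasZeroObject T] [HasShift T ℤ] [Preadditive T]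
  [∀ n : ℤ, (shiftFunctor T n).Additive] [Pretriangulated T]

/-- The maps which vanish on all maps from objects of `U`. -/
def IsGhost (U : ObjectProperty T) {X Y : T} (f : X ⟶ Y) : Prop :=
  ∀ K, U K → ∀ g : K ⟶ X, g ≫ f = 0

/-- The composites of `n` ghosts (any map, if `n = 0`). -/
def GhostPow (U : ObjectProperty T) : ℕ → ∀ {X Y : T}, (X ⟶ Y) → Prop
  | 0, _, _, _ => True
  | n + 1, X, Y, φ => ∃ (Z : T) (g : X ⟶ Z) (h : Z ⟶ Y), IsGhost U g ∧ GhostPow U n h ∧ g ≫ h = φ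

/-- The objects on which all composites of `n` ghosts vanish. -/
def Killed (U : ObjectProperty T) (n : ℕ) : ObjectProperty T :=
  fun E => ∀ ⦃X Y : T⦄ (φ : X ⟶ Y), GhostPow U n φ → ∀ f : E ⟶ X, f ≫ φ = 0

variable {U V : ObjectProperty T}

lemma GhostPow.anti (hUV : U ≤ V) {n : ℕ} {X Y : T} {φ : X ⟶ Y} (h : GhostPow V n φ) :
    GhostPow U n φ := by
  induction n generalizing X with
  | zero => trivial
  | succ n ih =>
    obtain ⟨Z, g, k, hg, hk, rfl⟩ := h
    exact ⟨Z, g, k, fun K hK => hg K (hUV K hK), ih hk, rfl⟩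

lemma GhostPow.split {a b : ℕ} {X Z : T} {φ : X ⟶ Z} (hφ : GhostPow U (b + a) φ) :
    ∃ (Y : T) (f : X ⟶ Y) (g : Y ⟶ Z), GhostPow U a f ∧ GhostPow U b g ∧ f ≫ g = φ := by
  induction a generalizing X with
  | zero => exact ⟨X, 𝟙 X, φ, trivial, hφ, by simp⟩
  | succ a ih =>
    obtain ⟨W, g, k, hg, hk, rfl⟩ := hφ
    obtain ⟨Y, f, g', hf, hg', rfl⟩ := ih hk
    exact ⟨Y, g ≫ f, g', ⟨W, g, f, hg, hf, rfl⟩, hg', by simp⟩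

lemma Killed.mono (hUV : U ≤ V) {n : ℕ} : Killed U n ≤ Killed V n :=
  fun _ hE _ _ φ hφ f => hE φ (hφ.anti hUV) f

/-- The ghost lemma: after the first `a` ghosts the map vanishes on `X`, so it factors through `Z`,
where the other `b` kill it. -/
lemma Killed.ext {a b : ℕ} {X Y Z : T} {x : X ⟶ Y} {y : Y ⟶ Z} {z : Z ⟶ X⟦(1 : ℤ)⟧}
    (h : Triangle.mk x y z ∈ distTriang T) (hX : Killed U a X) (hZ : Killed U b Z) :
    Killed U (b + a) Y := by
  intro C D φ hφ f
  obtain ⟨E, g, k, hg, hk, rfl⟩ := hφ.split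
  obtain ⟨l, hl⟩ := dist_desc₃ h (f ≫ g) (by rw [← Category.assoc]; exact hX g hg _)
  rw [← Category.assoc, ← hl, Category.assoc, hZ k hk, comp_zero]

lemma Killed.retract {n : ℕ} {X Y : T} (r : Retract X Y) (hY : Killed U n Y) : Killed U n X := by
  intro C D φ hφ f
  rw [← Category.id_comp f, ← r.retract, Category.assoc, Category.assoc, ← Category.assoc r.r,
    hY φ hφ, comp_zero]

lemma Killed.bigAdd {X : T} (hX : bigAdd U X) : Killed U 1 X := by
  obtain ⟨J, ⟨p⟩⟩ := hX
  rintro C D _ ⟨Z, g, k, hg, -, rfl⟩ f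
  refine p.isColimit.hom_ext (fun j => ?_)
  rw [comp_zero, ← Category.assoc, ← Category.assoc, hg _ (p.prop_diag_obj j), zero_comp]

lemma Killed.extensionProductIter {n : ℕ} {X : T}
    (hX : (GApprox.bigAdd U).extensionProductIter n X) : Killed U (n + 1) X := by
  induction n generalizing X with
  | zero => exact Killed.bigAdd hX
  | succ n ih =>
    rw [ObjectProperty.extensionProductIter_succ] at hX
    obtain ⟨X', X'', i, j, d, hT, hX', hX''⟩ := hX
    exact Killed.ext hT (Killed.bigAdd hX') (ih hX'')

lemma Killed.big {G : ℤ → ObjectProperty T} {I : Set ℤ} {n : ℕ} (hn : 0 < n) {X : T}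
    (hX : big G I n X) : Killed (slice G I) n X := by
  obtain ⟨Y, hY, ⟨r⟩⟩ := hX
  have h1 : Killed (slice G I) (n - 1 + 1) Y := Killed.extensionProductIter hY
  rw [Nat.sub_add_cancel hn] at h1
  exact h1.retract r

lemma exists_killed_of_small {G : ℤ → ObjectProperty T} {I : Set ℤ} {K : T} (hK : small G I K) :
    ∃ n, Killed (slice G I) n K := by
  have hP : ExtRetractClosed (fun K => ∃ n, Killed (slice G I) n K) :=
    { zero := fun X h => ⟨0, fun C D φ _ f => h.eq_of_src _ _⟩
      ext := fun h ⟨a, ha⟩ ⟨b, hb⟩ => ⟨b + a, Killed.ext h ha hb⟩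
      retract := fun r ⟨n, hn⟩ => ⟨n, hn.retract r⟩ }
  refine hP.small_le (fun X hX => ⟨1, ?_⟩) K hK
  rintro C D _ ⟨Z, g, k, hg, -, rfl⟩ f
  rw [← Category.assoc, hg X hX, zero_comp]

end Ghosts

/-! ### The closure of the compacts and its approximations -/

section Data

variable {T : Type u} [Category.{v} T] [HasZeroObject T] [HasShift T ℤ] [Preadditive T]
  [∀ n : ℤ, (shiftFunctor T n).Additive] [Pretriangulated T]

/-- A finite generating sequence with a metric and a constant witnessing quasiapproximability. -/
structure QuasiapproximationData (G M : ℤ → ObjectProperty T) (A : ℕ) : Prop where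
  generating : IsFiniteGeneratingSequence G
  coproducts : HasCoproducts.{v} T
  metric : IsOrthogonalMetric M
  pos : 0 < A
  preapproximable : IsPreapproximableWith G M A
  orth : ∀ n i : ℤ, (A : ℤ) ≤ n + i → M i ≤ (G n).rightOrthogonal
  approx : ∀ (i : ℤ) (F : T), M i F → closureCompacts G F →
      ∃ (E D : T) (a : E ⟶ F) (b : F ⟶ D) (c : D ⟶ E⟦(1 : ℤ)⟧),
        Triangle.mk a b c ∈ distTriang T ∧ big G (Set.Icc (-A - i) (A - i)) A E ∧
          M (i + 1) D ∧ closureCompacts G D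

namespace QuasiapproximationData

variable {G M : ℤ → ObjectProperty T} {A : ℕ} (h : QuasiapproximationData G M A)

include h

lemma gen : IsGeneratingSequence G := h.generating.toIsGeneratingSequence

lemma compacts_closed : ExtRetractClosed (compacts T) := compacts_of_extRetractClosed h.gen

lemma metric_closed (i : ℤ) : ExtRetractClosed (M i) := by
  rw [← h.metric.orthogonal i]
  exact leftOrthogonal_extRetractClosed _

lemma metric_anti {i j : ℤ} (hij : i ≤ j) : M j ≤ M i := by
  induction j, hij using Int.leInduction with
  | base => exact le_rfl
  | succ j _ ih => exact fun X hX => ih X (h.metric.anti j X hX)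

lemma metric_shift {i a : ℤ} (ha : a.natAbs ≤ 1) {X : T} (hX : M (i + 1) X) : M i (X⟦a⟧) := by
  obtain rfl | rfl | rfl : a = -1 ∨ a = 0 ∨ a = 1 := by omega
  · exact h.metric.shift_neg i X hX
  · exact (h.metric_closed i).shift_zero.2 (h.metric.anti i X hX)
  · exact h.metric.shift_pos i X hX

/-- Take double orthogonals in condition (1); `M i` equals its own. -/
lemma metricR_le (i : ℤ) : metricR G (i + A) ≤ M i := by
  rw [← h.metric.orthogonal i]
  exact fun X hX Y f hY => hX f (fun K g hK => hY g (h.preapproximable.le i K hK))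

lemma metricR_le' {i n : ℤ} (hn : i + A ≤ n) : metricR G n ≤ M i :=
  (metricR_anti G hn).trans (h.metricR_le i)

lemma hom_eq_zero {i m : ℤ} (hm : A - i ≤ m) {K X : T} (hK : small G (Set.Ici m) K) (hX : M i X)
    (f : K ⟶ X) : f = 0 :=
  small_hom_eq_zero (I := Set.Ici m) (fun n hn L hL g => h.orth n i (by
    simp only [Set.mem_Ici] at hn; omega) X hX g hL) hK f

lemma eventually_hom_eq_zero {K : T} (hK : compacts T K) :
    ∃ N : ℤ, ∀ n ≥ N, ∀ X, metricR G n X → ∀ f : K ⟶ X, f = 0 := by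
  obtain ⟨m, hm⟩ := exists_small_Icc h.gen hK
  refine ⟨2 * A + m, fun n hn X hX f => ?_⟩
  exact h.hom_eq_zero (i := n - A) (m := -m) (by omega)
    (small_mono G (fun x hx => hx.1) _ hm) (h.metricR_le' (by omega) _ hX) f

lemma compacts_le_closure : compacts T ≤ closureCompacts G := fun X hX _ =>
  ⟨_, _, _, _, _, contractible_distinguished X, hX, (metricR_extRetractClosed G _).zero _
    (isZero_zero T)⟩

lemma exists_metric {X : T} (hX : closureCompacts G X) : ∃ i, M i X := by
  obtain ⟨E, D, a, b, c, hT, hE, hD⟩ := hX 0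
  obtain ⟨m, hm⟩ := exists_small_Icc h.gen hE
  refine ⟨-m - A, (h.metric_closed _).ext hT ?_ (h.metricR_le' (by omega) _ hD)⟩
  exact h.preapproximable.le _ _ (small_mono G (fun x hx => by
    simp only [Set.mem_Icc, Set.mem_Iic] at hx ⊢; omega) _ hm)

lemma closure_shift {X : T} (hX : closureCompacts G X) (n : ℤ) : closureCompacts G (X⟦n⟧) := by
  intro m
  obtain ⟨E, D, a, b, c, hT, hE, hD⟩ := hX (m + |n|)
  exact ⟨_, _, _, _, _, Triangle.shift_distinguished _ hT n, compacts_shift h.gen hE n,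
    metricR_shift h.gen le_rfl hD⟩

lemma closure_iso {X Y : T} (e : X ≅ Y) (hX : closureCompacts G X) : closureCompacts G Y :=
  fun n => ObjectProperty.prop_of_iso _ e (hX n)

variable [IsTriangulated T]

/-- The approximation of `X` is chosen first, then that of `Y` so fine that `E₁ ⟶ Y` lifts to `E₂`.
The error of the cone contains `D₁⟦1⟧`, whence the depth `n + 1` for `X`. -/
lemma closure_cone {X Y Z : T} {a : X ⟶ Y} {b : Y ⟶ Z} {c : Z ⟶ X⟦(1 : ℤ)⟧}
    (hT : Triangle.mk a b c ∈ distTriang T) (hX : closureCompacts G X) (hY : closureCompacts G Y) :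
    closureCompacts G Z := by
  intro n
  obtain ⟨E₁, D₁, i₁, p₁, q₁, h₁, hE₁, hD₁⟩ := hX (n + 1)
  obtain ⟨N, hN⟩ := h.eventually_hom_eq_zero hE₁
  obtain ⟨E₂, D₂, i₂, p₂, q₂, h₂, hE₂, hD₂⟩ := hY (max n N)
  obtain ⟨e, he⟩ := dist_lift₁ h₂ (i₁ ≫ a) (hN _ (le_max_right _ _) D₂ hD₂ _)
  obtain ⟨E₃, e', e'', hE⟩ := distinguished_cocone_triangle e
  obtain ⟨D₃, i₃, p₃, q₃, r, s, t, h₃, h₄⟩ := exists_cone_map hE hT h₁ h₂ he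
  exact ⟨E₃, D₃, i₃, p₃, q₃, h₃, compacts_cone h.gen hE hE₁ hE₂,
    (metricR_extRetractClosed G n).ext h₄ (metricR_anti G (le_max_left _ _) _ hD₂)
      (metricR_shift_one h.gen (by simp) hD₁)⟩

lemma closure_cone_triangle (t : Triangle T) (ht : t ∈ distTriang T)
    (h₁ : closureCompacts G t.obj₁) (h₂ : closureCompacts G t.obj₂) : closureCompacts G t.obj₃ :=
  h.closure_cone (a := t.mor₁) (b := t.mor₂) (c := t.mor₃) ht h₁ h₂

lemma closure_ext {X Y Z : T} {a : X ⟶ Y} {b : Y ⟶ Z} {c : Z ⟶ X⟦(1 : ℤ)⟧}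
    (hT : Triangle.mk a b c ∈ distTriang T) (hX : closureCompacts G X) (hZ : closureCompacts G Z) :
    closureCompacts G Y :=
  h.closure_cone_triangle _ (inv_rot_of_distTriang _ hT) (h.closure_shift hZ _) hX

lemma closure_fibre {X Y Z : T} {a : X ⟶ Y} {b : Y ⟶ Z} {c : Z ⟶ X⟦(1 : ℤ)⟧}
    (hT : Triangle.mk a b c ∈ distTriang T) (hY : closureCompacts G Y) (hZ : closureCompacts G Z) :
    closureCompacts G X :=
  h.closure_cone_triangle _ (inv_rot_of_distTriang _ (inv_rot_of_distTriang _ hT))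
    (h.closure_shift hY _) (h.closure_shift hZ _)

variable (R : Type w) [CommRing R] [IsNoetherianRing R] [Linear R T]

lemma closure_le_finiteHoms (hfin : compacts T ≤ FiniteHoms R) :
    closureCompacts G ≤ FiniteHoms R := by
  intro X hX K hK
  obtain ⟨N, hN⟩ := h.eventually_hom_eq_zero hK
  obtain ⟨E, D, a, b, c, hT, hE, hD⟩ := hX N
  have := hfin E hE K hK
  refine Module.Finite.of_surjective (Linear.rightComp R K a) (fun f => ?_)
  exact dist_lift₁ hT f (hN N le_rfl D hD _)

/-- Approximation of an object of the closure by compact objects of bounded ghost length. -/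
lemma exists_approx (hfin : compacts T ≤ FiniteHoms R) {i : ℤ} {F : T} (hF : M i F)
    (hF' : closureCompacts G F) (l : ℕ) :
    ∃ (E D : T) (a : E ⟶ F) (b : F ⟶ D) (c : D ⟶ E⟦(1 : ℤ)⟧),
      Triangle.mk a b c ∈ distTriang T ∧ small G (Set.Icc (-A - i - l) (A - i)) E ∧
      Killed (slice G (Set.Icc (-A - i - l) (A - i))) (A * (l + 1)) E ∧
      M (i + l + 1) D ∧ closureCompacts G D := by
  have one : ∀ (j : ℤ) (F : T), M j F → closureCompacts G F →
      ∃ (E D : T) (a : E ⟶ F) (b : F ⟶ D) (c : D ⟶ E⟦(1 : ℤ)⟧),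
        Triangle.mk a b c ∈ distTriang T ∧ small G (Set.Icc (-A - j) (A - j)) E ∧
        Killed (slice G (Set.Icc (-A - j) (A - j))) A E ∧ M (j + 1) D ∧ closureCompacts G D := by
    intro j F hF hF'
    obtain ⟨E, D, a, b, c, hT, hE, hD, hD'⟩ := h.approx j F hF hF'
    -- As a fibre of objects of the closure, the big approximant has finitely generated Homs, so it
    -- is small.
    have hE' := h.closure_le_finiteHoms R hfin _ (h.closure_fibre hT hF' hD')
    exact ⟨E, D, a, b, c, hT, small_of_big R h.generating hfin (Set.finite_Icc _ _) hE hE',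
      Killed.big h.pos hE, hD, hD'⟩
  induction l with
  | zero => simpa using one i F hF hF'
  | succ l ih =>
    obtain ⟨E, D, a, b, c, hT, hE, hk, hD, hD'⟩ := ih
    obtain ⟨E₂, D₂, a₂, b₂, c₂, hT₂, hE₂, hk₂, hD₂, hD₂'⟩ := one _ D hD hD'
    obtain ⟨Z, z, d, p, q, h1, h2, -⟩ := exists_fibre_comp hT hT₂
    have s1 : Set.Icc (-A - i - l) (A - i) ⊆ Set.Icc (-A - i - ((l + 1 : ℕ) : ℤ)) (A - i) :=
      Set.Icc_subset_Icc (by push_cast; omega) le_rfl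
    have s2 : Set.Icc (-A - (i + l + 1)) (A - (i + l + 1)) ⊆
        Set.Icc (-A - i - ((l + 1 : ℕ) : ℤ)) (A - i) :=
      Set.Icc_subset_Icc (by push_cast; omega) (by omega)
    refine ⟨Z, D₂, z, b ≫ b₂, d, h1, (small_extRetractClosed G _).ext h2 (small_mono G s1 _ hE)
      (small_mono G s2 _ hE₂), ?_, by convert hD₂ using 1; push_cast; ring, hD₂'⟩
    have := Killed.ext h2 (hk.mono (slice_mono G s1)) (hk₂.mono (slice_mono G s2))
    convert this using 1
    ring

lemma exists_approx_Ici (hfin : compacts T ≤ FiniteHoms R) {F : T} (hF : closureCompacts G F)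
    (l : ℤ) :
    ∃ (E D : T) (a : E ⟶ F) (b : F ⟶ D) (c : D ⟶ E⟦(1 : ℤ)⟧),
      Triangle.mk a b c ∈ distTriang T ∧ small G (Set.Ici (-A - l)) E ∧
      M (l + 1) D ∧ closureCompacts G D := by
  obtain ⟨i, hi⟩ := h.exists_metric hF
  obtain ⟨k, hk⟩ : ∃ k : ℕ, min i l + k = l := ⟨(l - min i l).toNat, by omega⟩
  obtain ⟨E, D, a, b, c, hT, hE, -, hD, hD'⟩ :=
    h.exists_approx R hfin (h.metric_anti (min_le_left i l) _ hi) hF k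
  refine ⟨E, D, a, b, c, hT, small_mono G (fun x hx => ?_) _ hE, hk ▸ hD, hD'⟩
  simp only [Set.mem_Icc, Set.mem_Ici] at hx ⊢
  omega

/-- A converse to `metricR_le` on the closure. A map from a compact `K` to `D` factors through an
approximant `E` in `metricM G (m - A)`, since `K` has no maps to deep terms of the metric. Hence `f`
dies on `K` and factors through `D'`. -/
lemma metric_closure_le_metricR (hfin : compacts T ≤ FiniteHoms R) {m : ℤ} {D : T} (hD : M m D)
    (hD' : closureCompacts G D) : metricR G (m - A) D := by
  intro B f hB
  obtain ⟨K, D', a, b, c, hT, hK, hDR⟩ := hD' (m - A)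
  obtain ⟨n, hn⟩ := exists_small_Icc h.gen hK
  obtain ⟨l, hl⟩ : ∃ l : ℕ, (A : ℤ) - (m + l + 1) ≤ -n := ⟨(A - m + n).toNat, by omega⟩
  obtain ⟨E, D₁, a₁, b₁, c₁, hT₁, hE, -, hD₁, -⟩ := h.exists_approx R hfin hD hD' l
  obtain ⟨g, hg⟩ := dist_lift₁ hT₁ a (h.hom_eq_zero hl (small_mono G (fun x hx => hx.1) _ hn) hD₁ _)
  have hE' : a₁ ≫ f = 0 := hB _ (small_mono G (fun x hx => by
    simp only [Set.mem_Icc, Set.mem_Iic] at hx ⊢; omega) _ hE)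
  obtain ⟨k, rfl⟩ := dist_desc₃ hT f (by rw [← hg, Category.assoc, hE', comp_zero])
  rw [hDR k hB, comp_zero]

end QuasiapproximationData

end Data

end GApprox

namespace GApprox

/-! ### Killing maps into `F` by uniformly many ghosts -/

section Tower

variable {T : Type u} [Category.{v} T] [HasZeroObject T] [HasShift T ℤ] [Preadditive T]
  [∀ n : ℤ, (shiftFunctor T n).Additive] [Pretriangulated T]

/-- The maps out of `F` with fibre in the closure of the compacts and in the `i`-th term of `M`. -/
def FibreIn (G M : ℤ → ObjectProperty T) (i : ℤ) {F C : T} (φ : F ⟶ C) : Prop :=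
  ∃ (P : T) (p : P ⟶ F) (d : C ⟶ P⟦(1 : ℤ)⟧),
    Triangle.mk p φ d ∈ distTriang T ∧ closureCompacts G P ∧ M i P

/-- `F` is right bounded: maps from `𝒢ʲ` to `F` vanish for `j ≥ N`. -/
def BoundedAt (G : ℤ → ObjectProperty T) (N : ℤ) (F : T) : Prop :=
  ∀ j ≥ N, ∀ K, G j K → ∀ f : K ⟶ F, f = 0

/-- A composite of two maps which vanish on compact objects vanishes, if the first one starts
at `F`. -/
def PhantomsCompose (F : T) : Prop :=
  ∀ ⦃B B' : T⦄ (f : F ⟶ B) (g : B ⟶ B'), (∀ K, compacts T K → ∀ x : K ⟶ F, x ≫ f = 0) →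
    (∀ K, compacts T K → ∀ x : K ⟶ B, x ≫ g = 0) → f ≫ g = 0

/-- The first map vanishes on each `S n`, so it is `δ ≫ k`; the second kills `k`, whose source is a
coproduct of the compact objects `(S n)⟦1⟧`. -/
lemma phantomsCompose_hocolim {G : ℤ → ObjectProperty T} (hG : IsGeneratingSequence G)
    {S : ℕ ⥤ T} [HasColimitsOfShape (Discrete ℕ) T] {F : T} {π : (∐ S.obj) ⟶ F}
    {δ : F ⟶ (∐ S.obj)⟦(1 : ℤ)⟧} (h : Triangle.mk (telescope S) π δ ∈ distTriang T)
    (hS : ∀ n, compacts T (S.obj n)) : PhantomsCompose F := by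
  intro B B' f g hf hg
  obtain ⟨k, rfl⟩ := dist_desc₄ h f (Sigma.hom_ext _ _ (fun n => by
    rw [comp_zero, ← Category.assoc]
    exact hf _ (hS n) _))
  have h0 : k ≫ g = 0 := by
    let e := (shiftFunctorCompIsoId T (-1 : ℤ) 1 (by omega)).app B'
    obtain ⟨x, hx⟩ := (shiftFunctor T (1 : ℤ)).map_surjective ((k ≫ g) ≫ e.inv)
    have hx0 : x = 0 := by
      refine Sigma.hom_ext _ _ (fun n => (shiftFunctor T (1 : ℤ)).map_injective ?_)
      have := hg _ (compacts_shift hG (hS n) 1) ((Sigma.ι S.obj n)⟦(1 : ℤ)⟧' ≫ k)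
      rw [Functor.map_comp, hx, comp_zero, Functor.map_zero, ← Category.assoc, ← Category.assoc,
        this, zero_comp]
    rw [hx0, Functor.map_zero] at hx
    rw [← cancel_mono e.inv, ← hx, zero_comp]
  rw [Category.assoc, h0, comp_zero]

namespace QuasiapproximationData

variable [IsTriangulated T]
  {G M : ℤ → ObjectProperty T} {A : ℕ} (h : QuasiapproximationData G M A)
  (R : Type w) [CommRing R] [IsNoetherianRing R] [Linear R T]
  (hfin : compacts T ≤ FiniteHoms R) {F : T} {N : ℤ} (hF : FiniteHoms R F) (hN : BoundedAt G N F)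

include h hfin hN

/-- The part of `P` built from `𝒢^{[N,∞)}` maps to zero in `F` and can be divided out. The resulting
term of the metric does not depend on `P`, which keeps the tower below uniformly bounded. -/
lemma factors_through_metric {P : T} (hP : closureCompacts G P) (p : P ⟶ F) :
    ∃ (P' : T) (q : P ⟶ P') (p' : P' ⟶ F), q ≫ p' = p ∧ closureCompacts G P' ∧ M (1 - A - N) P' := by
  obtain ⟨E, D, a, b, c, hT, hE, hD, hD'⟩ := h.exists_approx_Ici R hfin hP (-A - N)
  obtain ⟨g, hg⟩ := dist_desc₃ hT p (small_hom_eq_zero (fun n hn K hK f => hN n (by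
    simp only [Set.mem_Ici] at hn; omega) K hK f) hE _)
  exact ⟨D, b, g, hg, hD', by convert hD using 1; ring⟩

include hF

/-- Only finitely many `𝒢ʲ` with `j ≥ m` map nontrivially to `C`, so one compact `L ⟶ C` covers all
these maps. Passing to its cone may push the fibre out of the fixed term of the metric;
`factors_through_metric` brings it back at the price of a further map `C₁ ⟶ C'`. -/
lemma exists_ghost_step (m : ℤ) {C : T} {φ : F ⟶ C} (hφ : FibreIn G M (1 - A - N) φ) :
    ∃ (C' : T) (ψ : C ⟶ C'), IsGhost (slice G (Set.Ici m)) ψ ∧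
      FibreIn G M (1 - A - N) (φ ≫ ψ) := by
  obtain ⟨P, p, d, hT, hP, hP'⟩ := hφ
  have hC : FiniteHoms R C := (finiteHoms_extRetractClosed R).ext (dist_rotate hT) hF
    (h.closure_le_finiteHoms R hfin _ (h.closure_shift hP 1))
  obtain ⟨N', hN'⟩ : ∃ N' : ℤ, BoundedAt G N' C := by
    -- `P⟦1⟧` lies in `M (-A - N)`, which is orthogonal to `𝒢ʲ` once `j ≥ 2 * A + N`.
    refine ⟨max N (2 * A + N), fun j hj K hK f => ?_⟩
    have h1 : f ≫ d = 0 := h.orth j (-A - N) (by omega) _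
      (h.metric_shift (a := 1) (by simp) (by convert hP' using 1; ring)) _ hK
    obtain ⟨g, rfl⟩ := dist_lift₂ hT f h1
    rw [hN j (by omega) K hK g, zero_comp]
  have hU : Set.Finite {X | slice G (Set.Icc m N') X} := by
    have : {X : T | slice G (Set.Icc m N') X} = ⋃ j ∈ Set.Icc m N', {X : T | G j X} := by
      ext X; simp [slice]
    rw [this]
    exact (Set.finite_Icc _ _).biUnion (fun j _ => h.generating.finite j)
  obtain ⟨L, k, hL, hk⟩ := exists_hom_cover (R := R) h.compacts_closed (slice G (Set.Icc m N')) hU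
    (fun X ⟨n, _, hX⟩ => h.gen.le_compacts n X hX) C hC
  obtain ⟨C₁, b, e, hC₁⟩ := distinguished_cocone_triangle k
  obtain ⟨Z, z, y, r, s, h1, h2, h3⟩ := exists_fibre_comp hT hC₁
  have hL' : compacts T L := coprod_le_compacts h.gen
    (fun X ⟨n, _, hX⟩ => h.gen.le_compacts n X hX) _ hL
  have hZ := h.closure_ext h2 hP (h.compacts_le_closure _ hL')
  obtain ⟨P', q, p', hq, hP₁, hP₂⟩ := h.factors_through_metric R hfin hN hZ z
  obtain ⟨C', x, t, hC'⟩ := distinguished_cocone_triangle p'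
  obtain ⟨g, hg⟩ := dist_desc₃ h1 x (by rw [← hq, Category.assoc, dist_comp₁₂ hC', comp_zero])
  refine ⟨C', b ≫ g, ?_, P', p', t, ?_, hP₁, hP₂⟩
  · rintro K ⟨j, hj, hK⟩ f
    rcases le_total j N' with hjN | hjN
    · obtain ⟨l, rfl⟩ := hk K ⟨j, ⟨hj, hjN⟩, hK⟩ f
      rw [Category.assoc, ← Category.assoc k, dist_comp₁₂ hC₁, zero_comp, comp_zero]
    · rw [hN' j hjN K hK f, zero_comp]
  · rw [← Category.assoc, hg]
    exact hC'

lemma exists_ghostPow (m : ℤ) (n : ℕ) {C : T} {φ : F ⟶ C} (hφ : FibreIn G M (1 - A - N) φ) :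
    ∃ (C' : T) (ψ : C ⟶ C'), GhostPow (slice G (Set.Ici m)) n ψ ∧
      FibreIn G M (1 - A - N) (φ ≫ ψ) := by
  induction n generalizing C with
  | zero => exact ⟨C, 𝟙 C, trivial, by rwa [Category.comp_id]⟩
  | succ n ih =>
    obtain ⟨C₁, g, hg, hφ₁⟩ := h.exists_ghost_step R hfin hF hN m hφ
    obtain ⟨C₂, k, hk, hφ₂⟩ := ih hφ₁
    exact ⟨C₂, g ≫ k, ⟨C₁, g, k, hg, hk, rfl⟩, by rwa [← Category.assoc]⟩

/-- The same `ψ` works for all `K`. Further ghosts `ψ'`, depending on `K`, push `f` into the fibre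
`Z` of `ψ ≫ ψ'`. As `Z` lies in `M (i - 1)` whatever `K` is, it has an approximant `E` of ghost
length `A * (l + 1)`, killed by `ψ`, and the remainder `D` receives no maps from `K`. -/
lemma exists_kill_small (m : ℤ) {C : T} {φ : F ⟶ C} (hφ : FibreIn G M (1 - A - N) φ) :
    ∃ (C' : T) (ψ : C ⟶ C'), FibreIn G M (1 - A - N) (φ ≫ ψ) ∧
      ∀ K, small G (Set.Ici m) K → ∀ f : K ⟶ C, f ≫ ψ = 0 := by
  set i : ℤ := 1 - A - N with hi
  -- `l` makes `D` orthogonal to `𝒢^{[m,∞)}`; `m'` is low enough for both `K` and the interval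
  -- generating `E`.
  obtain ⟨l, hl⟩ : ∃ l : ℕ, (A : ℤ) - (i - 1 + l + 1) ≤ m := ⟨(A - i - m).toNat, by omega⟩
  let m' : ℤ := min m (-A - (i - 1) - l)
  obtain ⟨C', ψ, hψ, hφ'⟩ := h.exists_ghostPow R hfin hF hN m' (A * (l + 1)) hφ
  refine ⟨C', ψ, hφ', fun K hK f => ?_⟩
  obtain ⟨n, hn⟩ := exists_killed_of_small hK
  obtain ⟨C'', ψ', hψ', hφ''⟩ := h.exists_ghostPow R hfin hF hN m' n hφ'
  obtain ⟨P, p, d, hT, hP, hP'⟩ := hφ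
  obtain ⟨P'', p'', d'', hT'', hP₁, hP₂⟩ := hφ''
  obtain ⟨Z, z, e, hZ⟩ := distinguished_cocone_triangle₁ (ψ ≫ ψ')
  let o := Triangulated.someOctahedron' (Category.assoc φ ψ ψ').symm hT hZ hT''
  have hZc : closureCompacts G Z := h.closure_cone o.mem hP hP₁
  have hZM : M (i - 1) Z := (h.metric_closed _).ext (dist_rotate o.mem)
    (h.metric_anti (by omega) _ hP₂)
    (h.metric_shift (a := 1) (by simp) (by convert hP' using 1; ring))
  obtain ⟨g, rfl⟩ := dist_lift₁ hZ f (by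
    rw [← Category.assoc]
    exact hn ψ' (hψ'.anti (slice_mono G (Set.Ici_subset_Ici.2 (min_le_left _ _)))) _)
  obtain ⟨E, D, a, b, c, hE, -, hEk, hD, -⟩ := h.exists_approx R hfin hZM hZc l
  obtain ⟨x, hx⟩ := dist_desc₃ hE (z ≫ ψ) (by
    rw [← Category.assoc]
    exact hEk ψ (hψ.anti (slice_mono G (fun y hy => (min_le_right _ _).trans hy.1))) _)
  rw [Category.assoc, ← hx, ← Category.assoc, h.hom_eq_zero hl hK hD (g ≫ b), zero_comp]

lemma exists_retract_triangle (hph : PhantomsCompose F) (q : ℤ) :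
    ∃ (P Y X : T) (a : P ⟶ Y) (b : Y ⟶ X) (c : X ⟶ P⟦(1 : ℤ)⟧),
      Triangle.mk a b c ∈ distTriang T ∧ closureCompacts G P ∧ metricR G q X ∧
      Nonempty (Retract F Y) := by
  -- The gap `4 * A + 1` forces maps from `𝒢^{[-2A-q,∞)}` to `X₁⟦1⟧` to vanish, so that in `key₂`
  -- maps to `C₁'` lift to `C₁`.
  obtain ⟨p, hp⟩ : ∃ p : ℤ, p = q + 4 * A + 1 := ⟨_, rfl⟩
  have h0 : FibreIn G M (1 - A - N) (𝟙 F) := ⟨_, _, _, contractible_distinguished₁ F,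
    h.compacts_le_closure _ (h.compacts_closed.zero _ (isZero_zero T)),
    (h.metric_closed _).zero _ (isZero_zero T)⟩
  obtain ⟨C₁, ψ₁, hφ₁, hk₁⟩ := h.exists_kill_small R hfin hF hN (-2 * A - p) h0
  obtain ⟨C₂, ψ₂, hφ₂, hk₂⟩ := h.exists_kill_small R hfin hF hN (-2 * A - p) hφ₁
  rw [Category.id_comp] at hφ₁ hφ₂
  obtain ⟨X₁, C₁', a₁, b₁, c₁, hT₁, hX₁, hC₁⟩ :=
    exists_metric_torsion_triangle h.generating h.coproducts p C₁
  obtain ⟨X₂, C₂', a₂, b₂, c₂, hT₂, hX₂, hC₂⟩ :=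
    exists_metric_torsion_triangle h.generating h.coproducts q C₂
  obtain ⟨x, hx⟩ := dist_desc₃ hT₁ (ψ₂ ≫ b₂) (metricR_anti G (by omega) _ hX₁ _ hC₂)
  have key₁ : ∀ K, compacts T K → ∀ y : K ⟶ F, y ≫ (ψ₁ ≫ b₁) = 0 := by
    intro K hK y
    obtain ⟨E, D, a, b, c, hT, hE, hD, hD'⟩ :=
      h.exists_approx_Ici R hfin (h.compacts_le_closure K hK) (p + A)
    obtain ⟨g, hg⟩ := dist_desc₃ hT (y ≫ ψ₁) (by
      rw [← Category.assoc]
      exact hk₁ E (small_mono G (Set.Ici_subset_Ici.2 (by omega)) _ hE) _)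
    have hDR := metricR_anti G (m := p) (by omega) _ (h.metric_closure_le_metricR R hfin hD hD')
    rw [← Category.assoc, ← hg, Category.assoc, hDR (g ≫ b₁) hC₁, comp_zero]
  have key₂ : ∀ K, compacts T K → ∀ y : K ⟶ C₁', y ≫ x = 0 := by
    intro K hK y
    obtain ⟨E, D, a, b, c, hT, hE, hD, hD'⟩ :=
      h.exists_approx_Ici R hfin (h.compacts_le_closure K hK) (q + A)
    obtain ⟨e, he⟩ := dist_lift₂ hT₁ (a ≫ y) (h.hom_eq_zero (i := p - 1 - A) (by omega) hE
      (h.metricR_le' (n := p - 1) (by omega) _ (metricR_shift_one h.gen (a := 1) (by simp)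
        (by convert hX₁ using 1; ring))) _)
    obtain ⟨g, hg⟩ := dist_desc₃ hT (y ≫ x) (by
      rw [← Category.assoc, ← he, Category.assoc, hx, ← Category.assoc,
        hk₂ E (small_mono G (Set.Ici_subset_Ici.2 (by omega)) _ hE) e, zero_comp])
    have hDR := metricR_anti G (m := q) (by omega) _ (h.metric_closure_le_metricR R hfin hD hD')
    rw [← hg, hDR g hC₂, comp_zero]
  have hzero := hph _ _ key₁ key₂
  rw [Category.assoc, hx] at hzero
  obtain ⟨P, p₀, d, hT, hP, -⟩ := hφ₂
  -- `Y` is the fibre of `F ⟶ C₂ ⟶ C₂'`; this composite is zero, so `Y ⟶ F` has a section.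
  obtain ⟨Y, y, e, r, s, h1, h2, h3⟩ := exists_fibre_comp hT hT₂
  obtain ⟨t, ht⟩ := dist_lift₁ h1 (𝟙 F) (by rw [Category.id_comp, Category.assoc, hzero])
  exact ⟨P, Y, X₂, r, s, _, h2, hP, hX₂, ⟨⟨t, y, ht⟩⟩⟩

end QuasiapproximationData

end Tower

end GApprox

namespace GApprox

/-! ### Splitting off the summand `F` -/

section Thick

variable {T : Type u} [Category.{v} T] [HasZeroObject T] [HasShift T ℤ] [Preadditive T]
  [∀ n : ℤ, (shiftFunctor T n).Additive] [Pretriangulated T]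

lemma dist_comp_iso₂ {X Y Y' Z : T} {a : X ⟶ Y} {b : Y ⟶ Z} {c : Z ⟶ X⟦(1 : ℤ)⟧}
    (h : Triangle.mk a b c ∈ distTriang T) (e : Y ≅ Y') :
    Triangle.mk (a ≫ e.hom) (e.inv ≫ b) c ∈ distTriang T :=
  isomorphic_distinguished _ h _ (Triangle.isoMk _ _ (Iso.refl _) e.symm (Iso.refl _)
    (by change (a ≫ e.hom) ≫ e.inv = 𝟙 X ≫ a; simp)
    (by change (e.inv ≫ b) ≫ 𝟙 Z = e.inv ≫ b; simp)
    (by change c ≫ (𝟙 X)⟦(1 : ℤ)⟧' = 𝟙 Z ≫ c; simp))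

lemma dist_comp_iso₃ {X Y Z Z' : T} {a : X ⟶ Y} {b : Y ⟶ Z} {c : Z ⟶ X⟦(1 : ℤ)⟧}
    (h : Triangle.mk a b c ∈ distTriang T) (e : Z ≅ Z') :
    Triangle.mk a (b ≫ e.hom) (e.inv ≫ c) ∈ distTriang T :=
  isomorphic_distinguished _ h _ (Triangle.isoMk _ _ (Iso.refl _) (Iso.refl _) e.symm
    (by change a ≫ 𝟙 Y = 𝟙 X ≫ a; simp)
    (by change (b ≫ e.hom) ≫ e.inv = 𝟙 Y ≫ b; simp)
    (by change (e.inv ≫ c) ≫ (𝟙 X)⟦(1 : ℤ)⟧' = e.inv ≫ c; simp))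

lemma dist_snd (X Y : T) :
    Triangle.mk (biprod.snd : X ⊞ Y ⟶ Y) 0 (-(biprod.inl : X ⟶ X ⊞ Y)⟦(1 : ℤ)⟧') ∈ distTriang T :=
  dist_rotate (binaryBiproductTriangle_distinguished X Y)

/-- The cone of the composite `V ⊕ U ⟶ U ⟶ U ⊕ V'` is `ΣV ⊕ V'`. -/
lemma exists_dist_snd_inl [IsTriangulated T] (V U V' : T) :
    ∃ (b : U ⊞ V' ⟶ V⟦(1 : ℤ)⟧ ⊞ V') (c : V⟦(1 : ℤ)⟧ ⊞ V' ⟶ (V ⊞ U)⟦(1 : ℤ)⟧),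
      Triangle.mk ((biprod.snd : V ⊞ U ⟶ U) ≫ (biprod.inl : U ⟶ U ⊞ V')) b c ∈ distTriang T := by
  have hU : Triangle.mk (biprod.inl : U ⟶ U ⊞ V') biprod.snd 0 ∈ distTriang T :=
    binaryBiproductTriangle_distinguished U V'
  obtain ⟨Z, b, c, p, q, h1, h2⟩ := exists_cone_comp (dist_snd V U) hU
  obtain ⟨e, -, -⟩ := exists_iso_binaryBiproduct_of_distTriang _ h2 zero_comp
  exact ⟨_, _, dist_comp_iso₃ h1 e⟩

lemma Retract.exists_iso_biprod {F Y : T} (r : Retract F Y) : ∃ F' : T, Nonempty (Y ≅ F ⊞ F') := by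
  obtain ⟨F', q, d, h⟩ := distinguished_cocone_triangle r.i
  have : Mono r.i := ⟨fun f g hfg => by simpa using hfg =≫ r.r⟩
  obtain ⟨e, -, -⟩ := exists_iso_binaryBiproduct_of_distTriang _ h
    (Triangle.mor₃_eq_zero_of_mono₁ _ h this)
  exact ⟨F', ⟨e⟩⟩

/-- Iterates condition (0). The bound on the shift is independent of the object, so error terms can
be made deep enough in advance. -/
lemma metricM_shift_iterate {G M : ℤ → ObjectProperty T} {A : ℕ}
    (hp : IsPreapproximableWith G M A) {i : ℤ} {X : T} (hX : metricM G i X) (k : ℕ) :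
    ∃ n : ℤ, |n| ≤ k * A ∧ metricM G (i + k) (X⟦n⟧) := by
  have hc := fun j => small_extRetractClosed G (Set.Iic (-j))
  induction k with
  | zero => exact ⟨0, by simp, (hc _).shift_zero.2 (by rw [Nat.cast_zero, add_zero]; exact hX)⟩
  | succ k ih =>
    obtain ⟨n, hn, hX'⟩ := ih
    obtain ⟨m, hm, Y, hY, ⟨e⟩⟩ := hp.shift _ _ hX'
    refine ⟨n + -m, ?_, ?_⟩
    · calc |n + -m| ≤ |n| + |-m| := abs_add_le _ _
        _ ≤ k * A + A := by rw [abs_neg]; exact add_le_add hn hm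
        _ = _ := by push_cast; ring
    · have e' : X⟦n + -m⟧ ≅ Y := (shiftFunctorAdd T n (-m)).app X ≪≫
        (shiftFunctor T (-m)).mapIso e ≪≫ (shiftFunctorCompIsoId T m (-m) (by omega)).app Y
      have : i + ((k + 1 : ℕ) : ℤ) = i + k + 1 := by push_cast; ring
      rw [this]
      exact (hc _).iso e'.symm hY

namespace QuasiapproximationData

variable [IsTriangulated T]
  {G M : ℤ → ObjectProperty T} {A : ℕ} (h : QuasiapproximationData G M A)

include h

lemma closure_biprod_comp {V U V' : T} (h₁ : closureCompacts G (V ⊞ U))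
    (h₂ : closureCompacts G (U ⊞ V')) : closureCompacts G (V⟦(1 : ℤ)⟧ ⊞ V') := by
  obtain ⟨b, c, hT⟩ := exists_dist_snd_inl V U V'
  exact h.closure_cone hT h₁ h₂

/-- With `S a b` as in the proof, `closure_biprod_comp` turns `S a b` and `S b c` into `S (a + 1)
c`. Taking `c = b - 1`, a shift of the hypothesis, changes `a - b` by two; hence odd differences
only. -/
lemma closure_biprod_shift {F : T} (h₁ : closureCompacts G (F⟦(1 : ℤ)⟧ ⊞ F⟦(0 : ℤ)⟧)) {n : ℤ}
    (hn : Odd n) : closureCompacts G (F⟦n⟧ ⊞ F⟦(0 : ℤ)⟧) := by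
  have : ∀ c : ℤ, PreservesBinaryBiproducts (shiftFunctor T c) := fun c =>
    preservesBinaryBiproducts_of_preservesBiproducts _
  let S : ℤ → ℤ → Prop := fun a b => closureCompacts G (F⟦a⟧ ⊞ F⟦b⟧)
  have symm : ∀ {a b}, S a b → S b a := fun hab => h.closure_iso (biprod.braiding _ _) hab
  have shift : ∀ {a b} (c : ℤ), S a b → S (a + c) (b + c) := fun {a b} c hab =>
    h.closure_iso ((shiftFunctor T c).mapBiprod _ _ ≪≫ biprod.mapIso
      ((shiftFunctorAdd T a c).symm.app F) ((shiftFunctorAdd T b c).symm.app F))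
      (h.closure_shift hab c)
  have cast : ∀ {a b a' b'}, S a b → a = a' → b = b' → S a' b' := by
    rintro a b _ _ hab rfl rfl; exact hab
  have comp : ∀ {a b c}, S a b → S b c → S (a + 1) c := fun {a b c} hab hbc =>
    h.closure_iso (biprod.mapIso ((shiftFunctorAdd T a 1).symm.app F) (Iso.refl _))
      (h.closure_biprod_comp hab hbc)
  have step : ∀ {a b}, S a b → S (a + 1) (b - 1) := fun {a b} hab =>
    comp hab (cast (shift (b - 1) h₁) (by ring) (by ring))
  have iter : ∀ (k : ℕ) {a b}, S a b → S (a + k) (b - k) := by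
    intro k
    induction k with
    | zero => intro a b hab; exact cast hab (by simp) (by simp)
    | succ k ih => intro a b hab; exact cast (step (ih hab)) (by push_cast; ring) (by push_cast; ring)
  have neg : ∀ k : ℕ, S (2 * k - 1) 0 := fun k =>
    cast (iter k (symm (shift (k - 1) h₁))) (by ring) (by ring)
  obtain ⟨m, rfl⟩ := hn
  rcases le_total 0 m with hm | hm
  · exact cast (neg (m + 1).toNat) (by omega) rfl
  · exact cast (shift (2 * m + 1) (symm (neg (-m).toNat))) (by omega) (by omega)

variable (R : Type w) [CommRing R] [IsNoetherianRing R] [Linear R T]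
  (hfin : compacts T ≤ FiniteHoms R)

include hfin

lemma exists_odd_shift {F W : T} (hW : closureCompacts G W) (r : Retract F W) (m : ℤ) :
    ∃ n : ℤ, Odd n ∧ metricR G m (F⟦n⟧) := by
  obtain ⟨a, ha⟩ := h.exists_metric hW
  obtain ⟨k, hk⟩ : ∃ k : ℕ, m + 1 ≤ a - A + k := ⟨(m + 1 - (a - A)).toNat, by omega⟩
  obtain ⟨l, hl⟩ : ∃ l : ℕ, m + 1 + k * A ≤ a + l + 1 - A :=
    -- `k` depends only on `a`, `m` and `A`, so `l` may be taken large enough afterwards for `D` to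
    -- survive a shift of size `k * A`. The spare step in `m + 1` pays for one more shift if `n` is
    -- even.
    ⟨(m + 1 + k * A - (a + 1 - A)).toNat, by omega⟩
  obtain ⟨E, D, x, y, z, hT, hE, -, hD, hD'⟩ := h.exists_approx R hfin ha hW l
  have hDR := h.metric_closure_le_metricR R hfin hD hD'
  obtain ⟨n, hn, hEn⟩ := metricM_shift_iterate h.preapproximable (i := a - A) (X := E)
    (small_mono G (fun t ht => by simp only [Set.mem_Icc, Set.mem_Iic] at ht ⊢; omega) _ hE) k
  have hc := metricR_extRetractClosed G (m + 1)
  have hWn : metricR G (m + 1) (W⟦n⟧) := (hc.shift n).ext hT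
    (metricR_anti G hk _ (metricM_le_metricR G _ _ hEn)) (metricR_shift h.gen (by omega) hDR)
  have hFn : metricR G (m + 1) (F⟦n⟧) := (hc.shift n).retract r hWn
  rcases Int.even_or_odd n with he | ho
  · exact ⟨n + 1, he.add_one, ((metricR_extRetractClosed G m).shift_iso rfl).1
      (metricR_shift_one h.gen (a := 1) (by simp) hFn)⟩
  · exact ⟨n, ho, metricR_anti G (by omega) _ hFn⟩

/-- With `F⟦n⟧` deep in the metric, projecting `F⟦n⟧ ⊞ F` to `F` alters the error term of an
approximation only by `F⟦n⟧⟦1⟧`. -/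
lemma closure_of_biprod_shift {F : T} (hW : closureCompacts G (F⟦(1 : ℤ)⟧ ⊞ F)) :
    closureCompacts G F := by
  have e : F⟦(1 : ℤ)⟧ ⊞ F ≅ F⟦(1 : ℤ)⟧ ⊞ F⟦(0 : ℤ)⟧ :=
    biprod.mapIso (Iso.refl _) ((shiftFunctorZero T ℤ).symm.app F)
  suffices closureCompacts G (F⟦(0 : ℤ)⟧) from h.closure_iso ((shiftFunctorZero T ℤ).app F) this
  intro m
  obtain ⟨n, hn, hFn⟩ := h.exists_odd_shift R hfin hW
    (⟨biprod.inr, biprod.snd, by simp⟩ : Retract F (F⟦(1 : ℤ)⟧ ⊞ F)) (m + 1)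
  obtain ⟨E, D, a, b, c, hT, hE, hD⟩ := h.closure_biprod_shift (h.closure_iso e hW) hn m
  obtain ⟨Z, x, y, p, q, h1, h2⟩ := exists_cone_comp hT (dist_snd (F⟦n⟧) (F⟦(0 : ℤ)⟧))
  exact ⟨E, Z, _, _, _, h1, hE, (metricR_extRetractClosed G m).ext h2 hD
    (metricR_shift_one h.gen (by simp) hFn)⟩

/-- Objects with finitely generated `Hom`s from compact objects which are right bounded and on
which phantoms compose to zero belong to the closure of the compacts. -/
theorem closure_of_bounded {F : T} {N : ℤ} (hF : FiniteHoms R F) (hN : BoundedAt G N F)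
    (hph : PhantomsCompose F) : closureCompacts G F := by
  refine h.closure_of_biprod_shift R hfin (fun n => ?_)
  obtain ⟨P, Y, X, a, b, c, hT, hP, hX, ⟨r⟩⟩ :=
    h.exists_retract_triangle R hfin hF hN hph (n + 4 * A + 1)
  obtain ⟨F', ⟨e⟩⟩ := Retract.exists_iso_biprod r
  obtain ⟨E₁, D₁, i₁, p₁, q₁, h₁, hE₁, hD₁, hD₁'⟩ := h.exists_approx_Ici R hfin hP (n + A)
  obtain ⟨E₂, D₂, i₂, p₂, q₂, h₂, hE₂, hD₂, hD₂'⟩ := h.exists_approx_Ici R hfin hP (n + 5 * A + 1)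
  obtain ⟨Z₁, x₁, y₁, _, _, k₁, l₁⟩ := exists_cone_comp h₁ hT
  obtain ⟨Z₂, x₂, y₂, _, _, k₂, l₂⟩ := exists_cone_comp h₂ hT
  have hZ₁ : metricR G (n + 1) Z₁ := (metricR_extRetractClosed G _).ext l₁
    (metricR_anti G (by omega) _ (h.metric_closure_le_metricR R hfin hD₁ hD₁'))
    (metricR_anti G (by omega) _ hX)
  have hZ₂ : metricR G (n + 4 * A + 1) Z₂ := (metricR_extRetractClosed G _).ext l₂
    (metricR_anti G (by omega) _ (h.metric_closure_le_metricR R hfin hD₂ hD₂')) hX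
  have k₁' := dist_comp_iso₂ k₁ e
  have k₂' := dist_comp_iso₂ k₂ (e ≪≫ biprod.braiding _ _)
  -- Both ends of `F ⊞ F' ⟶ F' ⟶ F' ⊞ F` are copies of `Y`, approximated by `E₁` and `E₂`. The depth
  -- `n + 4 * A + 1` of `Z₂` leaves no maps `E₁ ⟶ Z₂`, so the map lifts to the approximants.
  obtain ⟨u, v, hW⟩ := exists_dist_snd_inl F F' F
  obtain ⟨g, hg⟩ := dist_lift₁ k₂' (((i₁ ≫ a) ≫ e.hom) ≫ biprod.snd ≫ biprod.inl)
    (h.hom_eq_zero (i := n + 3 * A + 1) (by omega) hE₁ (h.metricR_le' (by omega) _ hZ₂) _)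
  obtain ⟨E₃, g', g'', hE⟩ := distinguished_cocone_triangle g
  obtain ⟨D₃, i₃, p₃, q₃, _, _, _, h₃, h₄⟩ := exists_cone_map hE hW k₁' k₂' hg
  exact ⟨E₃, D₃, i₃, p₃, q₃, h₃, compacts_cone h.gen hE (small_le_compacts h.gen _ _ hE₁)
    (small_le_compacts h.gen _ _ hE₂), (metricR_extRetractClosed G n).ext h₄
      (metricR_anti G (by omega) _ hZ₂) (metricR_shift_one h.gen (by simp) hZ₁)⟩

end QuasiapproximationData

end Thick

end GApprox

namespace GApprox

/-! ### Cohomological functors and homotopy colimits -/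

section Pull

variable {T : Type u} [Category.{v} T] [HasZeroObject T] [HasShift T ℤ] [Preadditive T]
  [∀ n : ℤ, (shiftFunctor T n).Additive] [Pretriangulated T]
  {R : Type w} [CommRing R] [Linear R T]
  (H : (compacts T).FullSubcategoryᵒᵖ ⥤ ModuleCat.{v} R)

/-- The action of the presheaf `H` on a morphism of compact objects. -/
def pull {K L : (compacts T).FullSubcategory} (f : K ⟶ L) : H.obj (op L) →ₗ[R] H.obj (op K) :=
  (H.map f.op).hom

lemma pull_id {K : (compacts T).FullSubcategory} (y : H.obj (op K)) : pull H (𝟙 K) y = y := by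
  simp [pull]

lemma pull_comp {K L M : (compacts T).FullSubcategory} (f : K ⟶ L) (g : L ⟶ M)
    (y : H.obj (op M)) : pull H (f ≫ g) y = pull H f (pull H g y) := by
  simp [pull]

variable {H}

lemma IsCohomological.pull_add (hH : IsCohomological H) {K L : (compacts T).FullSubcategory}
    (f g : K ⟶ L) (y : H.obj (op L)) : pull H (f + g) y = pull H f y + pull H g y := by
  have := hH.additive
  change (H.map (f.op + g.op)).hom y = _
  rw [H.map_add]
  rfl

lemma IsCohomological.pull_smul (hH : IsCohomological H) {K L : (compacts T).FullSubcategory}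
    (r : R) (f : K ⟶ L) (y : H.obj (op L)) : pull H (r • f) y = r • pull H f y := by
  rw [pull, hH.map_smul]
  rfl

/-- For `z ∈ H(B)`, the map `Hom(X, B) → H(X)` given by `z`. -/
def IsCohomological.evalHom (hH : IsCohomological H) (X : (compacts T).FullSubcategory)
    {B : (compacts T).FullSubcategory} (z : H.obj (op B)) :
    (X.obj ⟶ B.obj) →ₗ[R] H.obj (op X) where
  toFun f := pull H (ObjectProperty.homMk f) z
  map_add' f g := hH.pull_add (ObjectProperty.homMk f) (ObjectProperty.homMk g) z
  map_smul' r f := hH.pull_smul r (ObjectProperty.homMk f) z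

lemma IsCohomological.pull_zero (hH : IsCohomological H) {K L : (compacts T).FullSubcategory}
    {f : K ⟶ L} (hf : f.hom = 0) (y : H.obj (op L)) : pull H f y = 0 := by
  have := (hH.evalHom K y).map_zero
  rw [← hf] at this
  exact this

lemma IsCohomological.pull_sub (hH : IsCohomological H) {K L : (compacts T).FullSubcategory}
    (f g : K ⟶ L) (y : H.obj (op L)) : pull H (f - g) y = pull H f y - pull H g y :=
  (hH.evalHom K y).map_sub f.hom g.hom

lemma IsCohomological.exists_pull (hH : IsCohomological H) {X Y Z : (compacts T).FullSubcategory}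
    {a : X ⟶ Y} {b : Y ⟶ Z} {c : Z.obj ⟶ X.obj⟦(1 : ℤ)⟧}
    (h : Triangle.mk a.hom b.hom c ∈ distTriang T) (y : H.obj (op Y)) (hy : pull H a y = 0) :
    ∃ z, pull H b z = y :=
  (hH.exact X Y Z a b c h y).1 hy

/-- Add to `K` a compact `S` carrying generators of `H` on `U`, then take the cone of a compact `L`
covering the kernel of `Hom(-, K ⊞ S) ⟶ H` on `U`. The element `z` dies on `L`, so by exactness it
extends to the cone. -/
lemma IsCohomological.exists_step [IsNoetherianRing R] {G : ℤ → ObjectProperty T}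
    (hG : IsGeneratingSequence G) (hfin : compacts T ≤ FiniteHoms R) (hH : IsCohomological H)
    (hHf : ∀ K : (compacts T).FullSubcategory, Module.Finite R (H.obj (op K)))
    (U : ObjectProperty T) (hU : Set.Finite {X | U X})
    (K : (compacts T).FullSubcategory) (x : H.obj (op K)) :
    ∃ (K' : (compacts T).FullSubcategory) (x' : H.obj (op K')) (t : K ⟶ K'), pull H t x' = x ∧
      (∀ X : (compacts T).FullSubcategory, U X.obj → ∀ y, ∃ f : X ⟶ K', pull H f x' = y) ∧
      ∀ X : (compacts T).FullSubcategory, U X.obj → ∀ f : X ⟶ K, pull H f x = 0 → f ≫ t = 0 := by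
  have hc := compacts_of_extRetractClosed hG
  obtain ⟨S, y, -, -, hS⟩ := exists_cover H hc hH.additive hH.map_smul (fun _ => ⊤) (by simp) U hU
    (fun X _ => (hHf X).fg_top)
  let B : (compacts T).FullSubcategory := ⟨K.obj ⊞ S.obj, hc.biprod K.2 S.2⟩
  let iK : K ⟶ B := ObjectProperty.homMk biprod.inl
  let iS : S ⟶ B := ObjectProperty.homMk biprod.inr
  let pK : B ⟶ K := ObjectProperty.homMk biprod.fst
  let pS : B ⟶ S := ObjectProperty.homMk biprod.snd
  let z : H.obj (op B) := pull H pK x + pull H pS y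
  have hzK : pull H iK z = x := by
    have h1 : iK ≫ pK = 𝟙 K := by ext; exact biprod.inl_fst
    rw [map_add, ← pull_comp, ← pull_comp, h1, pull_id, hH.pull_zero (f := iK ≫ pS) biprod.inl_snd,
      add_zero]
  have hzS : pull H iS z = y := by
    have h1 : iS ≫ pS = 𝟙 S := by ext; exact biprod.inr_snd
    rw [map_add, ← pull_comp, ← pull_comp, h1, pull_id, hH.pull_zero (f := iS ≫ pK) biprod.inr_fst,
      zero_add]
  obtain ⟨L, l, -, hl, hL⟩ := exists_cover ((restrictedYoneda T R).obj B.obj) hc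
    (restrictedYoneda_additive _) (restrictedYoneda_map_smul _)
    (fun X => LinearMap.ker (hH.evalHom X z))
    (fun {X Y} s g hg => by
      change pull H (s ≫ ObjectProperty.homMk g) z = 0
      rw [pull_comp]
      exact (congrArg (pull H s) hg).trans (map_zero _)) U hU
    (fun X _ => by
      have := hfin _ B.2 _ X.2
      have : IsNoetherian R (X.obj ⟶ B.obj) := inferInstance
      exact this.noetherian _)
  let l' : L ⟶ B := ObjectProperty.homMk l
  obtain ⟨K', p, q, h⟩ := distinguished_cocone_triangle l'.hom
  let C : (compacts T).FullSubcategory := ⟨K', compacts_cone hG h L.2 B.2⟩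
  let p' : B ⟶ C := ObjectProperty.homMk p
  obtain ⟨x', hx'⟩ := hH.exists_pull (a := l') (b := p') h z hl
  refine ⟨C, x', iK ≫ p', by rw [pull_comp, hx', hzK], fun X hX w => ?_, fun X hX f hf => ?_⟩
  · obtain ⟨s, hs⟩ := hS X hX w trivial
    exact ⟨s ≫ iS ≫ p', by rw [pull_comp, pull_comp, hx', hzS]; exact hs⟩
  · obtain ⟨s, hs⟩ := hL X hX (f ≫ iK).hom (by
      change pull H (f ≫ iK) z = 0
      rw [pull_comp, hzK, hf])
    have hs' : s.hom ≫ l'.hom = (f ≫ iK).hom := hs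
    ext
    change f.hom ≫ iK.hom ≫ p = 0
    rw [← Category.assoc]
    change (f ≫ iK).hom ≫ p = 0
    rw [← hs', Category.assoc, dist_comp₁₂ h, comp_zero]

lemma exists_pointed_sequence {C : Type*} [Category C] {E : C → Type*}
    {P : ∀ (_ : ℕ) (p q : Σ X, E X), (p.1 ⟶ q.1) → Prop}
    (hP : ∀ n p, ∃ (q : Σ X, E X) (t : p.1 ⟶ q.1), P n p q t) (p₀ : Σ X, E X) :
    ∃ (S : ℕ ⥤ C) (x : ∀ n, E (S.obj n)), ∀ n : ℕ,
      P n ⟨S.obj n, x n⟩ ⟨S.obj (n + 1), x (n + 1)⟩ (S.map (homOfLE n.le_succ)) := by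
  choose q t ht using hP
  let p : ℕ → Σ X, E X := fun n => Nat.rec p₀ (fun n z => q n z) n
  refine ⟨Functor.ofSequence (X := fun n => (p n).1) (fun n => t n (p n)), fun n => (p n).2,
    fun n => ?_⟩
  erw [Functor.ofSequence_map_homOfLE_succ]
  exact ht _ _

lemma IsCohomological.exists_sequence [IsNoetherianRing R] {G : ℤ → ObjectProperty T}
    (hG : IsGeneratingSequence G) (hfin : compacts T ≤ FiniteHoms R) (hH : IsCohomological H)
    (hHf : ∀ K : (compacts T).FullSubcategory, Module.Finite R (H.obj (op K)))
    (U : ℕ → ObjectProperty T) (hU : ∀ n, Set.Finite {X | U n X}) :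
    ∃ (S : ℕ ⥤ (compacts T).FullSubcategory) (x : ∀ n, H.obj (op (S.obj n))), ∀ n : ℕ,
      pull H (S.map (homOfLE n.le_succ)) (x (n + 1)) = x n ∧
      (∀ X : (compacts T).FullSubcategory, U n X.obj → ∀ y, ∃ f : X ⟶ S.obj (n + 1),
        pull H f (x (n + 1)) = y) ∧
      ∀ X : (compacts T).FullSubcategory, U n X.obj → ∀ f : X ⟶ S.obj n, pull H f (x n) = 0 →
        f ≫ S.map (homOfLE n.le_succ) = 0 :=
  exists_pointed_sequence (E := fun K => H.obj (op K))
    (P := fun n p q t => pull H t q.2 = p.2 ∧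
      (∀ X : (compacts T).FullSubcategory, U n X.obj → ∀ y, ∃ f : X ⟶ q.1, pull H f q.2 = y) ∧
      ∀ X : (compacts T).FullSubcategory, U n X.obj → ∀ f : X ⟶ p.1, pull H f p.2 = 0 → f ≫ t = 0)
    (fun n p => by
      obtain ⟨K', x', t, ht⟩ := hH.exists_step hG hfin hHf (U n) (hU n) p.1 p.2
      exact ⟨⟨K', x'⟩, t, ht⟩)
    ⟨⟨_, (compacts_of_extRetractClosed hG).zero _ (isZero_zero T)⟩, 0⟩

/-- The comparison map `Hom(-, F) ⟶ H` for the homotopy colimit `F` of a sequence of compact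
objects with compatible elements of `H`. -/
lemma IsCohomological.exists_comparison {G : ℤ → ObjectProperty T}
    (hG : IsGeneratingSequence G) (hH : IsCohomological H)
    [HasColimitsOfShape (Discrete ℕ) T] (S : ℕ ⥤ (compacts T).FullSubcategory)
    (x : ∀ n, H.obj (op (S.obj n)))
    (hx : ∀ n : ℕ, pull H (S.map (homOfLE n.le_succ)) (x (n + 1)) = x n) {F : T}
    {π : (∐ (S ⋙ (compacts T).ι).obj) ⟶ F} {δ : F ⟶ (∐ (S ⋙ (compacts T).ι).obj)⟦(1 : ℤ)⟧}
    (h : Triangle.mk (telescope (S ⋙ (compacts T).ι)) π δ ∈ distTriang T) :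
    ∃ θ : ∀ K : (compacts T).FullSubcategory, (K.obj ⟶ F) →ₗ[R] H.obj (op K),
      (∀ {K L : (compacts T).FullSubcategory} (s : K ⟶ L) (f : L.obj ⟶ F),
        θ K (s.hom ≫ f) = pull H s (θ L f)) ∧
      ∀ {K : (compacts T).FullSubcategory} (n : ℕ) (g : K ⟶ S.obj n),
        θ K (g.hom ≫ Sigma.ι (S ⋙ (compacts T).ι).obj n ≫ π) = pull H g (x n) := by
  let S' := S ⋙ (compacts T).ι
  let j : ∀ n, (S.obj n).obj ⟶ F := fun n => Sigma.ι S'.obj n ≫ π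
  have hj : ∀ {m n : ℕ} (hmn : m ≤ n), (S.map (homOfLE hmn)).hom ≫ j n = j m :=
    fun hmn => map_hocolim h hmn
  have hx' : ∀ {m n : ℕ} (hmn : m ≤ n), pull H (S.map (homOfLE hmn)) (x n) = x m := by
    intro m n hmn
    induction n, hmn using Nat.le_induction with
    | base => rw [show homOfLE (le_refl m) = 𝟙 m from rfl, S.map_id, pull_id]
    | succ n hmn ih => rw [← homOfLE_comp hmn n.le_succ, S.map_comp, pull_comp, hx, ih]
  have ex : ∀ {K : (compacts T).FullSubcategory} (f : K.obj ⟶ F),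
      ∃ (n : ℕ) (g : K ⟶ S.obj n), f = g.hom ≫ j n := by
    intro K f
    obtain ⟨n, g, hg⟩ := factors_hocolim hG h K.2 f
    exact ⟨n, ObjectProperty.homMk g, hg⟩
  have lift : ∀ {K : (compacts T).FullSubcategory} {m n : ℕ} (_ : m ≤ n) (g : K ⟶ S.obj m),
      ∃ g' : K ⟶ S.obj n, g'.hom ≫ j n = g.hom ≫ j m ∧ pull H g' (x n) = pull H g (x m) := by
    intro K m n hmn g
    refine ⟨g ≫ S.map (homOfLE hmn), ?_, by rw [pull_comp, hx']⟩
    rw [← hj hmn]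
    exact Category.assoc _ _ _
  -- Well-definedness: maps from a compact object which agree in `F` agree at a finite stage.
  have uniq : ∀ {K : (compacts T).FullSubcategory} {m n : ℕ} (g : K ⟶ S.obj m) (g' : K ⟶ S.obj n),
      g.hom ≫ j m = g'.hom ≫ j n → pull H g (x m) = pull H g' (x n) := by
    intro K m n g g' hgg
    obtain ⟨a, ha, ha'⟩ := lift (le_max_left m n) g
    obtain ⟨b, hb, hb'⟩ := lift (le_max_right m n) g'
    obtain ⟨k, hk, h0⟩ := eventually_zero_of_hocolim h K.2 (a - b).hom (by
      change (a.hom - b.hom) ≫ j _ = 0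
      rw [Preadditive.sub_comp, ha, hb, hgg, sub_self])
    rw [← ha', ← hb', ← sub_eq_zero, ← hH.pull_sub, ← hx' hk, ← pull_comp]
    exact hH.pull_zero h0 _
  choose N g hg using @ex
  have eval : ∀ {K : (compacts T).FullSubcategory} (n : ℕ) (f : K ⟶ S.obj n),
      pull H (g (f.hom ≫ j n)) (x _) = pull H f (x n) := fun n f => uniq _ _ (hg _).symm
  refine ⟨fun K =>
    { toFun := fun f => pull H (g f) (x _)
      map_add' := fun f f' => ?_
      map_smul' := fun r f => ?_ }, fun {K L} s f => ?_, fun n f => eval n f⟩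
  · obtain ⟨a, ha, ha'⟩ := lift (le_max_left (N f) (N f')) (g f)
    obtain ⟨b, hb, hb'⟩ := lift (le_max_right (N f) (N f')) (g f')
    rw [← ha', ← hb', ← hH.pull_add]
    refine uniq _ _ ((hg _).symm.trans ?_)
    change _ = (a.hom + b.hom) ≫ j _
    rw [Preadditive.add_comp, ha, hb, ← hg, ← hg]
  · rw [RingHom.id_apply, ← hH.pull_smul]
    refine uniq _ _ ((hg _).symm.trans ?_)
    change _ = (r • (g f).hom) ≫ j _
    rw [Linear.smul_comp, ← hg]
  · change pull H (g (s.hom ≫ f)) (x _) = pull H s (pull H (g f) (x _))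
    rw [← pull_comp]
    refine uniq _ _ ((hg _).symm.trans ?_)
    change _ = (s.hom ≫ (g f).hom) ≫ j _
    rw [Category.assoc, ← hg]

lemma exists_dist_invRotate {X Y Z : T} {a : X ⟶ Y} {b : Y ⟶ Z} {c : Z ⟶ X⟦(1 : ℤ)⟧}
    (h : Triangle.mk a b c ∈ distTriang T) :
    ∃ (d : Z⟦(-1 : ℤ)⟧ ⟶ X) (e : Y ⟶ (Z⟦(-1 : ℤ)⟧)⟦(1 : ℤ)⟧), Triangle.mk d a e ∈ distTriang T :=
  ⟨_, _, inv_rot_of_distTriang _ h⟩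

/-- The compact objects on which a transformation is bijective. -/
def BijectiveAt {F : T} (θ : ∀ K : (compacts T).FullSubcategory, (K.obj ⟶ F) →ₗ[R] H.obj (op K)) :
    ObjectProperty T :=
  fun X => ∃ hX : compacts T X, Function.Bijective (θ ⟨X, hX⟩)

section FiveLemma

variable (hH : IsCohomological H) {F : T}
  {θ : ∀ K : (compacts T).FullSubcategory, (K.obj ⟶ F) →ₗ[R] H.obj (op K)}
  (hθ : ∀ {K L : (compacts T).FullSubcategory} (s : K ⟶ L) (f : L.obj ⟶ F),
        θ K (s.hom ≫ f) = pull H s (θ L f))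
  {G : ℤ → ObjectProperty T} (hG : IsGeneratingSequence G)

include hθ hG hH

lemma bijectiveAt_retract {X Y : T} (r : Retract X Y) (hY : BijectiveAt θ Y) :
    BijectiveAt θ X := by
  obtain ⟨hYc, hinj, hsurj⟩ := hY
  have hXc := (compacts_of_extRetractClosed hG).retract r hYc
  let i : (⟨X, hXc⟩ : (compacts T).FullSubcategory) ⟶ ⟨Y, hYc⟩ := ObjectProperty.homMk r.i
  let p : (⟨Y, hYc⟩ : (compacts T).FullSubcategory) ⟶ ⟨X, hXc⟩ := ObjectProperty.homMk r.r
  have hip : i ≫ p = 𝟙 _ := by ext; exact r.retract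
  have hip' : r.i ≫ r.r = 𝟙 _ := r.retract
  refine ⟨hXc, fun f g hfg => ?_, fun y => ?_⟩
  · have h1 : p.hom ≫ f = p.hom ≫ g := hinj (by rw [hθ, hθ, hfg])
    have h2 : r.i ≫ r.r ≫ f = r.i ≫ r.r ≫ g := congrArg (r.i ≫ ·) h1
    rwa [← Category.assoc, ← Category.assoc, hip', Category.id_comp, Category.id_comp] at h2
  · obtain ⟨f, hf⟩ := hsurj (pull H p y)
    exact ⟨i.hom ≫ f, by rw [hθ, hf, ← pull_comp, hip, pull_id]⟩

/-- The five lemma: injectivity at `Y` uses surjectivity at `X⟦1⟧`, and surjectivity at `Y` uses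
injectivity at `Z⟦-1⟧`. -/
lemma bijectiveAt_ext {X Y Z : T} {a : X ⟶ Y} {b : Y ⟶ Z} {c : Z ⟶ X⟦(1 : ℤ)⟧}
    (h : Triangle.mk a b c ∈ distTriang T) (hX : BijectiveAt θ X) (hZ : BijectiveAt θ Z)
    (hX' : BijectiveAt θ (X⟦(1 : ℤ)⟧)) (hZ' : BijectiveAt θ (Z⟦(-1 : ℤ)⟧)) : BijectiveAt θ Y := by
  obtain ⟨hXc, hX⟩ := hX
  obtain ⟨hZc, hZ⟩ := hZ
  obtain ⟨hXc', hX'⟩ := hX'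
  obtain ⟨hZc', hZ'⟩ := hZ'
  have hYc := (compacts_of_extRetractClosed hG).ext h hXc hZc
  obtain ⟨d, e, hd⟩ := exists_dist_invRotate h
  let a' : (⟨X, hXc⟩ : (compacts T).FullSubcategory) ⟶ ⟨Y, hYc⟩ := ObjectProperty.homMk a
  let b' : (⟨Y, hYc⟩ : (compacts T).FullSubcategory) ⟶ ⟨Z, hZc⟩ := ObjectProperty.homMk b
  let c' : (⟨Z, hZc⟩ : (compacts T).FullSubcategory) ⟶ ⟨X⟦(1 : ℤ)⟧, hXc'⟩ := ObjectProperty.homMk c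
  let d' : (⟨Z⟦(-1 : ℤ)⟧, hZc'⟩ : (compacts T).FullSubcategory) ⟶ ⟨X, hXc⟩ := ObjectProperty.homMk d
  refine ⟨hYc, (injective_iff_map_eq_zero _).2 (fun f hf => ?_), fun y => ?_⟩
  · have h1 : a'.hom ≫ f = 0 := hX.1 (by rw [hθ, hf, map_zero, map_zero])
    obtain ⟨g, rfl⟩ := dist_desc₃ h f h1
    obtain ⟨u, hu⟩ := hH.exists_pull (a := b') (b := c') (dist_rotate h) (θ _ g)
      ((hθ b' g).symm.trans hf)
    obtain ⟨k, rfl⟩ := hX'.2 u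
    have h2 : c'.hom ≫ k = g := hZ.1 ((hθ c' k).trans hu)
    rw [← h2]
    change b ≫ c ≫ k = 0
    rw [← Category.assoc, dist_comp₂₃ h, zero_comp]
  · obtain ⟨k, hk⟩ := hX.2 (pull H a' y)
    have h1 : d'.hom ≫ k = 0 := hZ'.1 (by
      rw [hθ, hk, ← pull_comp, map_zero]
      exact hH.pull_zero (dist_comp₁₂ hd) y)
    obtain ⟨f, hf⟩ := dist_desc₃ hd k h1
    obtain ⟨z, hz⟩ := hH.exists_pull (a := a') (b := b') h (y - θ _ f) (by
      rw [map_sub, ← hk, ← hθ, sub_eq_zero]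
      exact congrArg _ hf.symm)
    obtain ⟨g, rfl⟩ := hZ.2 z
    refine ⟨f + b'.hom ≫ g, ?_⟩
    rw [map_add, hθ, hz, add_sub_cancel]

/-- The five lemma involves neighbouring shifts, so all shifts are treated at once. -/
lemma bijectiveAt_extRetractClosed :
    ExtRetractClosed (fun X => ∀ n : ℤ, BijectiveAt θ (X⟦n⟧)) where
  zero X hX n := by
    have hX' : IsZero (X⟦n⟧) := Functor.map_isZero _ hX
    refine ⟨(compacts_of_extRetractClosed hG).zero _ hX', fun f g _ => hX'.eq_of_src _ _,
      fun y => ⟨0, ?_⟩⟩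
    rw [map_zero, ← pull_id H y]
    exact (hH.pull_zero (hX'.eq_of_src _ _) y).symm
  ext {X Y Z a b c} h hX hZ n := by
    have iso : ∀ {X Y : T}, (X ≅ Y) → BijectiveAt θ X → BijectiveAt θ Y := fun e hX =>
      bijectiveAt_retract hH hθ hG (Retract.ofIso e.symm) hX
    exact bijectiveAt_ext hH hθ hG (Triangle.shift_distinguished _ h n) (hX n) (hZ n)
      (iso ((shiftFunctorAdd T n 1).app X) (hX (n + 1)))
      (iso ((shiftFunctorAdd T n (-1)).app Z) (hZ (n + -1)))
  retract r hY n := bijectiveAt_retract hH hθ hG (r.map (shiftFunctor T n)) (hY n)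

end FiveLemma

end Pull

end GApprox

namespace GApprox

/-! ### Representability and the theorem -/

section Representability

variable {T : Type u} [Category.{v} T] [HasZeroObject T] [HasShift T ℤ] [Preadditive T]
  [∀ n : ℤ, (shiftFunctor T n).Additive] [Pretriangulated T]
  {R : Type w} [CommRing R] [Linear R T]
  {H : (compacts T).FullSubcategoryᵒᵖ ⥤ ModuleCat.{v} R}

/-- The shifts by at most `l` of the objects of the `𝒢ʲ` with `|j| ≤ l`. -/
def shiftedSlice (G : ℤ → ObjectProperty T) (l : ℕ) : ObjectProperty T :=
  fun X => ∃ a ∈ Set.Icc (-(l : ℤ)) l, ∃ j ∈ Set.Icc (-(l : ℤ)) l, ∃ Y, G j Y ∧ Y⟦a⟧ = X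

lemma shiftedSlice_finite {G : ℤ → ObjectProperty T} (hG : IsFiniteGeneratingSequence G) (l : ℕ) :
    Set.Finite {X | shiftedSlice G l X} := by
  have : {X : T | shiftedSlice G l X} = ⋃ a ∈ Set.Icc (-(l : ℤ)) l, ⋃ j ∈ Set.Icc (-(l : ℤ)) l,
      (fun Y : T => Y⟦a⟧) '' {Y | G j Y} := by
    ext X; simp only [shiftedSlice, Set.mem_iUnion, Set.mem_image, Set.mem_ofPred_eq, exists_prop]
  rw [this]
  exact (Set.finite_Icc _ _).biUnion (fun a _ => (Set.finite_Icc _ _).biUnion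
    (fun j _ => (hG.finite j).image _))

/-- A cohomological functor with finitely generated values is represented by the homotopy colimit
of a sequence of compact objects. -/
lemma IsCohomological.exists_representing [IsNoetherianRing R] {G : ℤ → ObjectProperty T}
    (hG : IsFiniteGeneratingSequence G) (hT : HasCoproducts.{v} T)
    (hfin : compacts T ≤ FiniteHoms R) (hH : IsCohomological H)
    (hHf : ∀ K : (compacts T).FullSubcategory, Module.Finite R (H.obj (op K))) :
    ∃ (F : T) (θ : ∀ K : (compacts T).FullSubcategory, (K.obj ⟶ F) →ₗ[R] H.obj (op K)),
      PhantomsCompose F ∧ (∀ {K L : (compacts T).FullSubcategory} (s : K ⟶ L) (f : L.obj ⟶ F),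
        θ K (s.hom ≫ f) = pull H s (θ L f)) ∧ ∀ K, Function.Bijective (θ K) := by
  have hG' := hG.toIsGeneratingSequence
  have := hasCoproducts_nat hT
  obtain ⟨S, x, hS⟩ := hH.exists_sequence hG' hfin hHf (shiftedSlice G) (shiftedSlice_finite hG)
  obtain ⟨F, π, δ, h⟩ := distinguished_cocone_triangle (telescope (S ⋙ (compacts T).ι))
  obtain ⟨θ, hθ, hθ'⟩ := hH.exists_comparison hG' S x (fun n => (hS n).1) h
  refine ⟨F, θ, phantomsCompose_hocolim hG' h (fun n => (S.obj n).2), hθ, ?_⟩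
  have hcl := bijectiveAt_extRetractClosed hH hθ hG'
  have key : ∀ X, compacts T X → ∀ n : ℤ, BijectiveAt θ (X⟦n⟧) := by
    rw [← hG'.generates]
    refine hcl.small_le ?_
    rintro Y ⟨j, -, hY⟩ a
    have hYa := compacts_shift hG' (hG'.le_compacts j Y hY) a
    -- `Y⟦a⟧` is a test object at every late stage: one such stage gives surjectivity, and one past
    -- the stage where `f` is represented gives injectivity.
    have hl : ∀ l : ℕ, a.natAbs + j.natAbs ≤ l → shiftedSlice G l (Y⟦a⟧) := fun l hl =>
      ⟨a, by simp only [Set.mem_Icc]; omega, j, by simp only [Set.mem_Icc]; omega, Y, hY, rfl⟩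
    refine ⟨hYa, (injective_iff_map_eq_zero _).2 (fun f hf => ?_), fun y => ?_⟩
    · obtain ⟨n, g, rfl⟩ := factors_hocolim hG' h hYa f
      let m := max n (a.natAbs + j.natAbs)
      let g' : (⟨Y⟦a⟧, hYa⟩ : (compacts T).FullSubcategory) ⟶ S.obj m :=
        ObjectProperty.homMk g ≫ S.map (homOfLE (le_max_left _ _))
      have hg' : g ≫ Sigma.ι (S ⋙ (compacts T).ι).obj n ≫ π =
          g'.hom ≫ Sigma.ι (S ⋙ (compacts T).ι).obj m ≫ π := by
        rw [← map_hocolim h (le_max_left n (a.natAbs + j.natAbs))]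
        exact (Category.assoc _ _ _).symm
      rw [hg', hθ'] at hf
      have h0 : g'.hom ≫ (S.map (homOfLE m.le_succ)).hom = 0 :=
        congrArg (fun t => t.hom) ((hS m).2.2 ⟨Y⟦a⟧, hYa⟩ (hl m (le_max_right _ _)) g' hf)
      rw [hg', ← map_succ_hocolim h, ← Category.assoc]
      exact (congrArg (· ≫ _) h0).trans zero_comp
    · obtain ⟨f, hf⟩ := (hS _).2.1 ⟨Y⟦a⟧, hYa⟩ (hl _ le_rfl) y
      exact ⟨_, (hθ' _ f).trans hf⟩
  intro K
  exact (bijectiveAt_retract hH hθ hG' (Retract.ofIso ((shiftFunctorZero T ℤ).symm.app K.obj))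
    (key K.obj K.2 0)).2

lemma IsGFinite.of_iso {G : ℤ → ObjectProperty T}
    {H' : (compacts T).FullSubcategoryᵒᵖ ⥤ ModuleCat.{v} R} (e : H ≅ H') (hH : IsGFinite G H) :
    IsGFinite G H' := by
  let φ : ∀ K, H.obj K ≃ₗ[R] H'.obj K := fun K => (e.app K).toLinearEquiv
  have nat : ∀ {K L} (f : K ⟶ L) (y : H.obj K),
      φ L ((H.map f).hom y) = (H'.map f).hom (φ K y) := fun f y =>
    congrArg (fun t => t.hom y) (e.hom.naturality f)
  have nat' : ∀ {K L} (f : K ⟶ L) (y : H'.obj K),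
      (H'.map f).hom y = φ L ((H.map f).hom ((φ K).symm y)) := fun f y => by
    rw [nat, LinearEquiv.apply_symm_apply]
  exact {
    additive := by
      have := hH.additive
      exact Functor.additive_of_iso e
    map_smul := fun {K L} f r => by
      ext y
      rw [nat', hH.map_smul]
      change φ _ (r • (H.map f.op).hom _) = r • (H'.map f.op).hom y
      rw [map_smul, nat' f.op]
    exact := fun X Y Z a b c hT y => by
      rw [nat', map_eq_zero_iff _ (φ _).injective, hH.exact X Y Z a b c hT]
      constructor
      · rintro ⟨z, hz⟩
        exact ⟨φ _ z, by rw [← nat, hz, LinearEquiv.apply_symm_apply]⟩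
      · rintro ⟨z, rfl⟩
        exact ⟨(φ _).symm z, by rw [nat', LinearEquiv.symm_apply_apply]⟩
    finite := fun K => by
      have := hH.finite K
      exact Module.Finite.equiv (φ (op K))
    bounded := by
      obtain ⟨N, hN⟩ := hH.bounded
      refine ⟨N, fun i hi K hK => ?_⟩
      have := hN i hi K hK
      exact (φ (op K)).symm.injective.subsingleton }

lemma restrictedYoneda_isCohomological (F : T) :
    IsCohomological ((restrictedYoneda T R).obj F) where
  additive := restrictedYoneda_additive F
  map_smul := restrictedYoneda_map_smul F
  exact X Y Z a b c h y := by
    constructor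
    · intro hy
      exact dist_desc₃ h y hy
    · rintro ⟨z, rfl⟩
      have (z : Z.obj ⟶ F) : a.hom ≫ b.hom ≫ z = 0 := by
        rw [← Category.assoc, dist_comp₁₂ h, zero_comp]
      exact this z

namespace QuasiapproximationData

variable [IsTriangulated T]
  {G M : ℤ → ObjectProperty T} {A : ℕ} (h : QuasiapproximationData G M A)

include h

lemma hom_ext_of_compacts {F F' : T} (hF : closureCompacts G F) {n : ℤ}
    (hF' : (metricM G n).rightOrthogonal F') {f g : F ⟶ F'}
    (hfg : ∀ K, compacts T K → ∀ k : K ⟶ F, k ≫ f = k ≫ g) : f = g := by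
  obtain ⟨E, D, a, b, c, hT, hE, hD⟩ := hF n
  obtain ⟨t, ht⟩ := dist_desc₃ hT (f - g) (by
    rw [Preadditive.comp_sub, hfg E hE a, sub_self])
  rw [← sub_eq_zero, ← ht, hD t hF', comp_zero]

/-- The value of `φ` on an approximation `E ⟶ F` extends to `F`; the depth `n + 1` pays for the
desuspension of `D`. A finer approximation, through which both `E` and a given `K` factor, shows
that the extension induces `φ` on `K`. -/
lemma exists_hom_of_natural {F F' : T} (hF : closureCompacts G F) {n : ℤ}
    (hF' : (metricM G n).rightOrthogonal F')
    (φ : ∀ K, compacts T K → (K ⟶ F) → (K ⟶ F'))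
    (hφ : ∀ K L (hK : compacts T K) (hL : compacts T L) (s : K ⟶ L) (f : L ⟶ F),
      φ K hK (s ≫ f) = s ≫ φ L hL f) :
    ∃ f : F ⟶ F', ∀ K hK (k : K ⟶ F), φ K hK k = k ≫ f := by
  have ex : ∀ {E D : T} {a : E ⟶ F} {b : F ⟶ D} {c : D ⟶ E⟦(1 : ℤ)⟧} (_ : Triangle.mk a b c ∈ distTriang T)
      (hE : compacts T E) (_ : metricR G (n + 1) D), ∃ f : F ⟶ F', a ≫ f = φ E hE a := by
    intro E D a b c hT hE hD
    obtain ⟨d, e, hd⟩ := exists_dist_invRotate hT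
    exact dist_desc₃ hd _ (metricR_shift_one h.gen (a := -1) (by simp) hD _ hF')
  obtain ⟨E, D, a, b, c, hT, hE, hD⟩ := hF (n + 1)
  obtain ⟨f, hf⟩ := ex hT hE hD
  refine ⟨f, fun K hK k => ?_⟩
  obtain ⟨N₁, hN₁⟩ := h.eventually_hom_eq_zero hK
  obtain ⟨N₂, hN₂⟩ := h.eventually_hom_eq_zero hE
  obtain ⟨N, hN₁', hN₂', hN⟩ : ∃ N : ℤ, N₁ ≤ N ∧ N₂ ≤ N ∧ n + 1 ≤ N :=
    ⟨max N₁ (max N₂ (n + 1)), by omega, by omega, by omega⟩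
  obtain ⟨E', D', a', b', c', hT', hE', hD'⟩ := hF N
  obtain ⟨f', hf'⟩ := ex hT' hE' (metricR_anti G hN _ hD')
  have through : ∀ {L : T} (hL : compacts T L) (l : L ⟶ F), l ≫ b' = 0 → φ L hL l = l ≫ f' := by
    intro L hL l hl
    obtain ⟨s, rfl⟩ := dist_lift₁ hT' l hl
    rw [hφ _ _ _ hE', ← hf', Category.assoc]
  have hff : f = f' := by
    obtain ⟨t, ht⟩ := dist_desc₃ hT (f - f') (by
      rw [Preadditive.comp_sub, hf, through hE a (hN₂ N hN₂' D' hD' _), sub_self])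
    rw [← sub_eq_zero, ← ht, metricR_anti G (by omega : n ≤ n + 1) _ hD t hF', comp_zero]
  rw [hff]
  exact through hK k (hN₁ N hN₁' D' hD' _)

variable [IsNoetherianRing R] (hfin : compacts T ≤ FiniteHoms R)

include hfin

lemma restrictedYoneda_isGFinite {F : T} (hF : boundedClosure G F) :
    IsGFinite G ((restrictedYoneda T R).obj F) := by
  obtain ⟨hF, n, hn⟩ := hF
  obtain ⟨i, hi⟩ := h.exists_metric hF
  rw [metricM_rightOrthogonal_iff] at hn
  refine ⟨restrictedYoneda_isCohomological F,
    fun K => h.closure_le_finiteHoms R hfin F hF K.obj K.2, |n| + |A - i|, fun j hj K hK => ?_⟩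
  have zero : ∀ f : K.obj ⟶ F, f = 0 := by
    intro f
    rcases abs_cases j with ⟨h1, h2⟩ | ⟨h1, h2⟩
    · exact h.orth j i (by have := le_abs_self (A - i); have := abs_nonneg n; omega) F hi f hK
    · exact hn j (by have := le_abs_self n; have := abs_nonneg (A - i); omega) K.obj hK f
  exact ⟨fun f g => (zero f).trans (zero g).symm⟩

lemma exists_representing_boundedClosure (hH : IsGFinite G H) :
    ∃ F, boundedClosure G F ∧ Nonempty ((restrictedYoneda T R).obj F ≅ H) := by
  obtain ⟨F, θ, hph, hθ, hbij⟩ :=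
    hH.toIsCohomological.exists_representing h.generating h.coproducts hfin hH.finite
  obtain ⟨N, hN⟩ := hH.bounded
  have zero : ∀ j : ℤ, N ≤ |j| → ∀ K, G j K → ∀ f : K ⟶ F, f = 0 := by
    intro j hj K hK f
    let K' : (compacts T).FullSubcategory := ⟨K, h.gen.le_compacts j K hK⟩
    have := hN j hj K' hK
    exact (hbij K').1 (Subsingleton.elim _ _)
  have hF : FiniteHoms R F := fun K hK => by
    have := hH.finite ⟨K, hK⟩
    exact Module.Finite.equiv (LinearEquiv.ofBijective (θ ⟨K, hK⟩) (hbij _)).symm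
  refine ⟨F, ⟨h.closure_of_bounded R hfin hF (N := N)
    (fun j hj => zero j (le_trans hj (le_abs_self j))) hph, N, ?_⟩, ⟨NatIso.ofComponents
      (fun K => (LinearEquiv.ofBijective (θ K.unop) (hbij _)).toModuleIso) (fun {K L} s => ?_)⟩⟩
  · rw [metricM_rightOrthogonal_iff]
    exact fun j hj => zero j (by have := neg_le_abs j; omega)
  · ext f
    exact hθ s.unop f

end QuasiapproximationData

end Representability

end GApprox

theorem mainTheorem2 {T : Type u} [Category.{v} T] [HasZeroObject T] [HasShift T ℤ]
    [Preadditive T] [∀ n : ℤ, (shiftFunctor T n).Additive] [Pretriangulated T] [IsTriangulated T]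
    (R : Type w) [CommRing R] [IsNoetherianRing R] [Linear R T]
    (G : ℤ → ObjectProperty T) (hG : GApprox.IsFiniteGeneratingSequence G)
    (hT : GApprox.IsQuasiapproximable G)
    (hfin : ∀ (m n : ℤ) (X Y : T), G m X → G n Y → Module.Finite R (X ⟶ Y)) :
    (∀ H : (GApprox.compacts T).FullSubcategoryᵒᵖ ⥤ ModuleCat.{v} R,
      (GApprox.restrictedYonedaBounded R G).essImage H ↔ GApprox.IsGFinite G H) ∧
    (GApprox.restrictedYonedaBounded R G).Full ∧
    (GApprox.restrictedYonedaBounded R G).Faithful := by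
  obtain ⟨M, A, hA, hM, hpre, horth, happrox⟩ := hT.exists_metric
  have h : GApprox.QuasiapproximationData G M A :=
    ⟨hG, hT.compactlyGenerated.hasCoproducts, hM, hA, hpre, horth, happrox⟩
  have hfin' := GApprox.compacts_le_finiteHoms R hG.toIsGeneratingSequence hfin
  refine ⟨fun H => ⟨?_, fun hH => ?_⟩, ⟨fun {F F'} φ => ?_⟩, ⟨fun {F F'} f g hfg => ?_⟩⟩
  · rintro ⟨F, ⟨e⟩⟩
    exact (h.restrictedYoneda_isGFinite hfin' F.2).of_iso e
  · obtain ⟨F, hF, ⟨e⟩⟩ := h.exists_representing_boundedClosure hfin' hH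
    exact ⟨⟨F, hF⟩, ⟨e⟩⟩
  · obtain ⟨n, hn⟩ := F'.2.2
    obtain ⟨f, hf⟩ := h.exists_hom_of_natural F.2.1 hn
      (fun K hK => (φ.app (op ⟨K, hK⟩)).hom) (fun K L hK hL s f =>
        congrArg (fun t => t.hom f) (φ.naturality (ObjectProperty.homMk s :
          (⟨K, hK⟩ : (GApprox.compacts T).FullSubcategory) ⟶ ⟨L, hL⟩).op))
    refine ⟨ObjectProperty.homMk f, ?_⟩
    ext K k
    exact (hf _ K.unop.2 k).symm
  · obtain ⟨n, hn⟩ := F'.2.2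
    ext
    refine h.hom_ext_of_compacts F.2.1 hn (fun K hK k => ?_)
    exact congrArg (fun t => (t.app (op ⟨K, hK⟩)).hom k) hfg
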